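/- Let $H$ be a complex Hilbert space and let $M\subseteq B(H)$ be a weak* closed subalgebra (resp. a weak* closed linear subspace closed under the Jordan product $a\circ b=\frac12(ab+ba)$) which is unital, that is, has an identity element of norm at most $1$ for its product (so of norm $1$ unless $M=\{0\}$; it need not be the identity operator of $H$). Identify $M_n(B(H))$ with $B(H^n)$, and call an operator $T$ real positive if $T+T^*\ge 0$. Let $\Phi:M\to M$ be a linear map which is weak* continuous, completely contractive (all the entrywise amplifications $M_n(M)\to M_n(M)$, $n\in\mathbb N$, are contractive for the norms of $B(H^n)$) and real completely positive (all these amplifications map real positive matrices to real positive matrices). Let $M^\Phi=\{x\in M:\Phi(x)=x\}$. Then there is a linear map $P:M\to M$ with $P\circ P=P$ and $P(M)=M^\Phi$ which is real completely positive and completely contractive, and such that $M^\Phi$ with the new product $(x,y)\mapsto P(xy)$ (resp. $(x,y)\mapsto P(x\circ y)$) is a unital dual operator algebra (resp. a unital Jordan operator algebra), in the following sense. In the associative case, $M^\Phi$ is weak* closed in $B(H)$, and there are a Hilbert space $K$, a weak* closed subalgebra $N\subseteq B(K)$ with an identity element of norm at most $1$, and a linear bijection $\pi:M^\Phi\to N$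 that is completely isometric, a homeomorphism for the relative weak* topologies, and satisfies $\pi(P(xy))=\pi(x)\pi(y)$ for all $x,y\in M^\Phi$. In the Jordan case, there are a Hilbert space $K$, a norm closed subspace $N\subseteq B(K)$ that is closed under the Jordan product and has an identity element of norm at most $1$ for it, and a completely isometric linear bijection $\pi:M^\Phi\to N$ with $\pi(P(x\circ y))=\pi(x)\circ\pi(y)$ for all $x,y\in M^\Phi$. -/

import Mathlib

namespace OperatorAlg

noncomputable section

open scoped InnerProductSpace Topology

universe u

section Operators

variable {H : Type u} [NormedAddCommGroup H] [InnerProductSpace ℂ H] [CompleteSpace H]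

/-- The weak* topology of `B(H)`, the dual of the trace class operators: the coarsest topology
for which `x ↦ ∑ₙ ⟪ηₙ, x ξₙ⟫` is continuous for all square summable sequences `ξ`, `η` in `H`. -/
abbrev weakStar (H : Type u) [NormedAddCommGroup H] [InnerProductSpace ℂ H] [CompleteSpace H] :
    TopologicalSpace (H →L[ℂ] H) :=
  TopologicalSpace.induced
    (fun (x : H →L[ℂ] H) (p : lp (fun _ : ℕ => H) 2 × lp (fun _ : ℕ => H) 2) =>
      ∑' n, ⟪p.2 n, x (p.1 n)⟫_ℂ)
    Pi.topologicalSpace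

/-- The relative weak* topology on a subspace of `B(H)`. -/
abbrev relWeakStar (S : Submodule ℂ (H →L[ℂ] H)) : TopologicalSpace S :=
  TopologicalSpace.induced (fun x : S => (x : H →L[ℂ] H)) (weakStar H)

/-- `S` is weak* closed in `B(H)`. -/
def IsWeakStarClosed (S : Submodule ℂ (H →L[ℂ] H)) : Prop :=
  IsClosed[weakStar H] (S : Set (H →L[ℂ] H))

/-- The operator on the Hilbert space direct sum `Hⁿ` defined by an `n × n` matrix of operators
on `H`; this is the identification of `Mₙ(B(H))` with `B(Hⁿ)`. -/
def matOp {n : ℕ} (a : Matrix (Fin n) (Fin n) (H →L[ℂ] H)) :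
    PiLp 2 (fun _ : Fin n => H) →L[ℂ] PiLp 2 (fun _ : Fin n => H) :=
  ((PiLp.continuousLinearEquiv 2 ℂ (fun _ : Fin n => H)).symm :
      (Fin n → H) →L[ℂ] PiLp 2 (fun _ : Fin n => H)) ∘L
    ContinuousLinearMap.pi (fun i => ∑ j, (a i j) ∘L PiLp.proj 2 (fun _ : Fin n => H) j)

theorem matOp_apply {n : ℕ} (a : Matrix (Fin n) (Fin n) (H →L[ℂ] H))
    (v : PiLp 2 (fun _ : Fin n => H)) (i : Fin n) : matOp a v i = ∑ j, a i j (v j) := by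
  simp [matOp]

/-- The operator on `Hⁿ` of an `n × n` matrix with entries in a subspace of `B(H)`. -/
def subMatOp (S : Submodule ℂ (H →L[ℂ] H)) {n : ℕ} (a : Matrix (Fin n) (Fin n) S) :
    PiLp 2 (fun _ : Fin n => H) →L[ℂ] PiLp 2 (fun _ : Fin n => H) :=
  matOp (a.map (fun x : S => (x : H →L[ℂ] H)))

/-- `T` is real positive (accretive): `T + T* ≥ 0`. -/
def IsRealPositive {E : Type u} [NormedAddCommGroup E] [InnerProductSpace ℂ E] [CompleteSpace E]
    (T : E →L[ℂ] E) : Prop :=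
  (T + ContinuousLinearMap.adjoint T).IsPositive

end Operators

section Maps

variable {H K : Type u} [NormedAddCommGroup H] [InnerProductSpace ℂ H] [CompleteSpace H]
  [NormedAddCommGroup K] [InnerProductSpace ℂ K] [CompleteSpace K]
  {S : Submodule ℂ (H →L[ℂ] H)} {R : Submodule ℂ (K →L[ℂ] K)}

/-- Every entrywise amplification of `T` takes real positive matrices to real positive ones. -/
def IsRealCompletelyPositive (T : S →ₗ[ℂ] R) : Prop :=
  ∀ (n : ℕ) (a : Matrix (Fin n) (Fin n) S),
    IsRealPositive (subMatOp S a) → IsRealPositive (subMatOp R (a.map T))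

/-- Every entrywise amplification of `T` is contractive. -/
def IsCompletelyContractive (T : S →ₗ[ℂ] R) : Prop :=
  ∀ (n : ℕ) (a : Matrix (Fin n) (Fin n) S), ‖subMatOp R (a.map T)‖ ≤ ‖subMatOp S a‖

/-- Every entrywise amplification of `T` is isometric. -/
def IsCompletelyIsometric (T : S →ₗ[ℂ] R) : Prop :=
  ∀ (n : ℕ) (a : Matrix (Fin n) (Fin n) S), ‖subMatOp R (a.map T)‖ = ‖subMatOp S a‖

/-- `T` is continuous for the relative weak* topologies. -/
def IsWeakStarContinuous (T : S →ₗ[ℂ] R) : Prop :=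
  Continuous[relWeakStar S, relWeakStar R] T

end Maps

section Algebras

variable {H : Type u} [NormedAddCommGroup H] [InnerProductSpace ℂ H] [CompleteSpace H]

/-- The Jordan product `a ∘ b = (ab + ba)/2` of operators. -/
def jordanMul (a b : H →L[ℂ] H) : H →L[ℂ] H := (2⁻¹ : ℂ) • (a * b + b * a)

/-- A unital operator algebra on `H`: a norm closed subalgebra of `B(H)` with a contractive
identity element `e`. It is not required that `e` be the identity operator of `H`. If the algebra
is nonzero then `‖e‖ = 1`; the zero algebra is allowed. -/
structure IsUnitalOperatorAlgebra (M : Submodule ℂ (H →L[ℂ] H)) : Prop where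
  isClosed : IsClosed (M : Set (H →L[ℂ] H))
  mul_mem : ∀ x ∈ M, ∀ y ∈ M, x * y ∈ M
  exists_unit : ∃ e ∈ M, ‖e‖ ≤ 1 ∧ ∀ x ∈ M, e * x = x ∧ x * e = x

/-- A unital Jordan operator algebra on `H`: a norm closed subspace of `B(H)` closed under the
Jordan product, with a contractive identity element for that product. -/
structure IsUnitalJordanOperatorAlgebra (M : Submodule ℂ (H →L[ℂ] H)) : Prop where
  isClosed : IsClosed (M : Set (H →L[ℂ] H))
  jordanMul_mem : ∀ x ∈ M, ∀ y ∈ M, jordanMul x y ∈ M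
  exists_unit : ∃ e ∈ M, ‖e‖ ≤ 1 ∧ ∀ x ∈ M, jordanMul e x = x

/-- The subspace `F` of `B(H)`, with its operator space structure and weak* topology inherited
from `B(H)`, is a unital dual operator algebra with the product `m`: it is weak* closed, and
some completely isometric weak* homeomorphism carries it and `m` onto a weak* closed unital
operator algebra on some Hilbert space with the operator product. -/
def IsUnitalDualOperatorAlgebraWith (F : Submodule ℂ (H →L[ℂ] H)) (m : F → F → F) : Prop :=
  IsWeakStarClosed F ∧
  ∃ (K : Type u) (_ : NormedAddCommGroup K) (_ : InnerProductSpace ℂ K) (_ : CompleteSpace K)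
    (N : Submodule ℂ (K →L[ℂ] K)) (π : F ≃ₗ[ℂ] N),
    IsUnitalOperatorAlgebra N ∧ IsWeakStarClosed N ∧
    IsCompletelyIsometric π.toLinearMap ∧
    IsWeakStarContinuous π.toLinearMap ∧ IsWeakStarContinuous π.symm.toLinearMap ∧
    ∀ x y : F, (π (m x y) : K →L[ℂ] K) = (π x : K →L[ℂ] K) * (π y : K →L[ℂ] K)

/-- The subspace `F` of `B(H)`, with its operator space structure inherited from `B(H)`, is a
unital Jordan operator algebra with the product `m`: it is completely isometrically Jordan
isomorphic to a unital Jordan operator algebra on some Hilbert space. -/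
def IsUnitalJordanOperatorAlgebraWith (F : Submodule ℂ (H →L[ℂ] H)) (m : F → F → F) : Prop :=
  ∃ (K : Type u) (_ : NormedAddCommGroup K) (_ : InnerProductSpace ℂ K) (_ : CompleteSpace K)
    (N : Submodule ℂ (K →L[ℂ] K)) (π : F ≃ₗ[ℂ] N),
    IsUnitalJordanOperatorAlgebra N ∧ IsCompletelyIsometric π.toLinearMap ∧
    ∀ x y : F, (π (m x y) : K →L[ℂ] K) = jordanMul (π x : K →L[ℂ] K) (π y : K →L[ℂ] K)

variable {M : Submodule ℂ (H →L[ℂ] H)}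

/-- The fixed point space `M^Φ`, as a subspace of `B(H)`. -/
def fixedSpace (Φ : M →ₗ[ℂ] M) : Submodule ℂ (H →L[ℂ] H) :=
  (LinearMap.eqLocus Φ LinearMap.id).map M.subtype

/-- The range `P(M)`, as a subspace of `B(H)`. -/
def rangeSpace (P : M →ₗ[ℂ] M) : Submodule ℂ (H →L[ℂ] H) :=
  LinearMap.range (M.subtype ∘ₗ P)

theorem rangeSpace_le (P : M →ₗ[ℂ] M) : rangeSpace P ≤ M := by
  rintro _ ⟨x, rfl⟩
  exact (P x).2

/-- The new product `(x, y) ↦ P(xy)` on `P(M)`. -/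
def newMul (hM : IsUnitalOperatorAlgebra M) (P : M →ₗ[ℂ] M) (x y : rangeSpace P) :
    rangeSpace P :=
  ⟨P ⟨(x : H →L[ℂ] H) * (y : H →L[ℂ] H),
      hM.mul_mem _ (rangeSpace_le P x.2) _ (rangeSpace_le P y.2)⟩, ⟨_, rfl⟩⟩

/-- The new Jordan product `(x, y) ↦ P(x ∘ y)` on `P(M)`. -/
def newJordanMul (hM : IsUnitalJordanOperatorAlgebra M) (P : M →ₗ[ℂ] M) (x y : rangeSpace P) :
    rangeSpace P :=
  ⟨P ⟨jordanMul (x : H →L[ℂ] H) (y : H →L[ℂ] H),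
      hM.jordanMul_mem _ (rangeSpace_le P x.2) _ (rangeSpace_le P y.2)⟩, ⟨_, rfl⟩⟩

end Algebras

end

end OperatorAlg

/-!
The projection `P` is an ultrafilter limit, in the point-weak topology, of the Cesàro means of the
powers of `Φ`; its range is the fixed space because `Φ` is weak* continuous on bounded sets.

The algebraic part concerns any idempotent, completely contractive and real completely positive
`P` on a unital (Jordan) operator algebra `M`. By Arveson's extension theorem and Ellis' lemma on
idempotents in compact right topological semigroups, `P` extends to an idempotent real completely
positive map `Q` on `B(H)`. Then the Choi–Effros identities `Q(Q(x)y) = Q(xy) = Q(xQ(y))` for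
`x`, `y` in the range give the associativity of `Q(xy)`, and a Kolmogorov decomposition of the
positive kernel `x, y ↦ Q(x*y)` turns left Choi–Effros multiplication into operator
multiplication.

This representation need not be weak* continuous, but the product `Q(xy)` on `P(M)` is separately
weak* continuous on bounded sets. Compressing to the closed span of the orbit of the embedded copy
of `H`, first under the adjoints and then under the representation itself, gives a representation
whose weak limits are determined by that product, and the Krein–Šmulian theorem passes from bounded
sets to the weak* topology.
-/

namespace OperatorAlg

noncomputable section

open scoped InnerProductSpace Topology ComplexConjugate
open Filter

universe u

/-! ## Weak operator limits and the weak* topology -/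

section WeakOperatorLimits

variable {H : Type u} [NormedAddCommGroup H] [InnerProductSpace ℂ H]

theorem norm_inner_apply_le (T : H →L[ℂ] H) {C : ℝ} (hT : ‖T‖ ≤ C) (η ξ : H) :
    ‖⟪η, T ξ⟫_ℂ‖ ≤ C * (‖η‖ * ‖ξ‖) := by
  calc ‖⟪η, T ξ⟫_ℂ‖ ≤ ‖η‖ * ‖T ξ‖ := norm_inner_le_norm _ _
    _ ≤ ‖η‖ * (C * ‖ξ‖) := by gcongr; exact T.le_of_opNorm_le hT ξ
    _ = C * (‖η‖ * ‖ξ‖) := by ring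

theorem re_inner_apply_self_le {T : H →L[ℂ] H} (hT : ‖T‖ ≤ 1) (ξ : H) :
    (⟪ξ, T ξ⟫_ℂ).re ≤ ‖ξ‖ ^ 2 := by
  simpa [sq] using (Complex.re_le_norm _).trans (norm_inner_apply_le T hT ξ ξ)

theorem opNorm_le_of_norm_inner_le {T : H →L[ℂ] H} {C : ℝ} (hC : 0 ≤ C)
    (h : ∀ η ξ : H, ‖⟪η, T ξ⟫_ℂ‖ ≤ C * (‖η‖ * ‖ξ‖)) : ‖T‖ ≤ C := by
  refine ContinuousLinearMap.opNorm_le_of_re_inner_le hC fun ξ η hξ hη => ?_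
  calc RCLike.re ⟪T ξ, η⟫_ℂ ≤ ‖⟪T ξ, η⟫_ℂ‖ := RCLike.re_le_norm _
    _ = ‖⟪η, T ξ⟫_ℂ‖ := norm_inner_symm _ _
    _ ≤ C := by simpa [hξ, hη] using h η ξ

theorem exists_clm_of_sesquilinear [CompleteSpace H] (B : H →ₗ⋆[ℂ] H →ₗ[ℂ] ℂ) {C : ℝ} (hC : 0 ≤ C)
    (bound : ∀ η ξ, ‖B η ξ‖ ≤ C * ‖η‖ * ‖ξ‖) :
    ∃ T : H →L[ℂ] H, ‖T‖ ≤ C ∧ ∀ η ξ, ⟪η, T ξ⟫_ℂ = B η ξ := by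
  let T := ContinuousLinearMap.adjoint
    (InnerProductSpace.continuousLinearMapOfBilin (B.mkContinuous₂ C bound))
  have hT : ∀ η ξ, ⟪η, T ξ⟫_ℂ = B η ξ := fun η ξ => by
    rw [ContinuousLinearMap.adjoint_inner_right,
      InnerProductSpace.continuousLinearMapOfBilin_apply, LinearMap.mkContinuous₂_apply]
  refine ⟨T, opNorm_le_of_norm_inner_le hC fun η ξ => ?_, hT⟩
  rw [hT, ← mul_assoc]
  exact bound η ξ

/-- `T` converges to `T₀` along `l` in the weak operator topology. -/
def WTendsto {α : Type*} (T : α → H →L[ℂ] H) (l : Filter α) (T₀ : H →L[ℂ] H) : Prop :=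
  ∀ η ξ : H, Tendsto (fun a => ⟪η, T a ξ⟫_ℂ) l (𝓝 ⟪η, T₀ ξ⟫_ℂ)

variable {α : Type*} {S T : α → H →L[ℂ] H} {l : Filter α} {S₀ T₀ : H →L[ℂ] H}

theorem wTendsto_const (S : H →L[ℂ] H) (l : Filter α) : WTendsto (fun _ => S) l S :=
  fun _ _ => tendsto_const_nhds

theorem wTendsto_of_tendsto (h : Tendsto T l (𝓝 T₀)) : WTendsto T l T₀ := fun η ξ =>
  ((by fun_prop : Continuous fun T : H →L[ℂ] H => ⟪η, T ξ⟫_ℂ).tendsto _).comp h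

namespace WTendsto

theorem unique [l.NeBot] {T₁ : H →L[ℂ] H} (h₀ : WTendsto T l T₀) (h₁ : WTendsto T l T₁) :
    T₀ = T₁ :=
  ContinuousLinearMap.ext fun ξ => ext_inner_left ℂ fun η => tendsto_nhds_unique (h₀ η ξ) (h₁ η ξ)

theorem congr' (h : WTendsto T l T₀) (hST : S =ᶠ[l] T) : WTendsto S l T₀ := fun η ξ =>
  (h η ξ).congr' (hST.symm.mono fun a ha => by simp only [ha])

theorem add (hS : WTendsto S l S₀) (hT : WTendsto T l T₀) :
    WTendsto (fun a => S a + T a) l (S₀ + T₀) := fun η ξ => by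
  simpa [inner_add_right] using (hS η ξ).add (hT η ξ)

theorem sub (hS : WTendsto S l S₀) (hT : WTendsto T l T₀) :
    WTendsto (fun a => S a - T a) l (S₀ - T₀) := fun η ξ => by
  simpa [inner_sub_right] using (hS η ξ).sub (hT η ξ)

theorem const_smul (hS : WTendsto S l S₀) (c : ℂ) :
    WTendsto (fun a => c • S a) l (c • S₀) := fun η ξ => by
  simpa [inner_smul_right] using (hS η ξ).const_mul c

theorem star [CompleteSpace H] (hS : WTendsto S l S₀) :
    WTendsto (fun a => star (S a)) l (star S₀) := fun η ξ => by
  simpa [ContinuousLinearMap.star_eq_adjoint, ContinuousLinearMap.adjoint_inner_right,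
    Function.comp_def] using (Complex.continuous_conj.tendsto _).comp (hS ξ η)

theorem norm_le [l.NeBot] (h : WTendsto T l T₀) {C : ℝ} (hC : ∀ᶠ a in l, ‖T a‖ ≤ C) :
    ‖T₀‖ ≤ C := by
  have hC₀ : 0 ≤ C := by
    obtain ⟨a, ha⟩ := hC.exists
    exact (norm_nonneg _).trans ha
  refine opNorm_le_of_norm_inner_le hC₀ fun η ξ => le_of_tendsto (h η ξ).norm ?_
  filter_upwards [hC] with a ha using norm_inner_apply_le _ ha _ _

end WTendsto

theorem exists_wTendsto [CompleteSpace H] (𝒰 : Ultrafilter α) (T : α → H →L[ℂ] H) {C : ℝ}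
    (hT : ∀ᶠ a in (𝒰 : Filter α), ‖T a‖ ≤ C) :
    ∃ T₀ : H →L[ℂ] H, ‖T₀‖ ≤ C ∧ WTendsto T 𝒰 T₀ := by
  have hC : 0 ≤ C := by
    obtain ⟨a, ha⟩ := hT.exists
    exact (norm_nonneg _).trans ha
  have limit : ∀ η ξ : H, ∃ z : ℂ, ‖z‖ ≤ C * (‖η‖ * ‖ξ‖) ∧
      Tendsto (fun a => ⟪η, T a ξ⟫_ℂ) 𝒰 (𝓝 z) := fun η ξ => by
    have hmem : ∀ᶠ a in (𝒰 : Filter α),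
        ⟪η, T a ξ⟫_ℂ ∈ Metric.closedBall (0 : ℂ) (C * (‖η‖ * ‖ξ‖)) := by
      filter_upwards [hT] with a ha
      exact mem_closedBall_zero_iff.2 (norm_inner_apply_le _ ha η ξ)
    obtain ⟨z, hz, hz'⟩ := (isCompact_closedBall (0 : ℂ) (C * (‖η‖ * ‖ξ‖))).ultrafilter_le_nhds
      (𝒰.map fun a => ⟪η, T a ξ⟫_ℂ) (le_principal_iff.2 hmem)
    exact ⟨z, by simpa using hz, hz'⟩
  choose G hG hGt using limit
  let B : H →ₗ⋆[ℂ] H →ₗ[ℂ] ℂ := LinearMap.mk₂'ₛₗ (starRingEnd ℂ) (RingHom.id ℂ) G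
    (fun η η' ξ => tendsto_nhds_unique (hGt _ _) (by
      simpa [inner_add_left] using (hGt η ξ).add (hGt η' ξ)))
    (fun c η ξ => tendsto_nhds_unique (hGt _ _) (by
      simpa [inner_smul_left, mul_comm] using (hGt η ξ).const_mul (conj c)))
    (fun η ξ ξ' => tendsto_nhds_unique (hGt _ _) (by
      simpa [inner_add_right] using (hGt η ξ).add (hGt η ξ')))
    (fun c η ξ => tendsto_nhds_unique (hGt _ _) (by
      simpa [inner_smul_right] using (hGt η ξ).const_mul c))
  obtain ⟨T₀, hT₀, h⟩ := exists_clm_of_sesquilinear B hC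
    fun η ξ => (hG η ξ).trans_eq (mul_assoc _ _ _).symm
  exact ⟨T₀, hT₀, fun η ξ => by rw [h]; exact hGt η ξ⟩

theorem exists_linearMap_wTendsto [CompleteSpace H] {E : Type*} [AddCommGroup E] [Module ℂ E]
    (𝒰 : Ultrafilter α) (T : α → E →ₗ[ℂ] (H →L[ℂ] H)) {C : E → ℝ}
    (hT : ∀ x, ∀ᶠ a in (𝒰 : Filter α), ‖T a x‖ ≤ C x) :
    ∃ T₀ : E →ₗ[ℂ] (H →L[ℂ] H), ∀ x, WTendsto (fun a => T a x) 𝒰 (T₀ x) := by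
  choose T₀ _ hT₀ using fun x => exists_wTendsto 𝒰 (fun a => T a x) (hT x)
  exact ⟨{ toFun := T₀
           map_add' := fun x y => (hT₀ (x + y)).unique (by simpa using (hT₀ x).add (hT₀ y))
           map_smul' := fun r x => (hT₀ (r • x)).unique (by simpa using (hT₀ x).const_smul r) },
    hT₀⟩

end WeakOperatorLimits

section WeakStar

theorem summable_norm_mul_norm {E : Type*} [NormedAddCommGroup E]
    (p : lp (fun _ : ℕ => E) 2 × lp (fun _ : ℕ => E) 2) :
    Summable fun n => ‖p.2 n‖ * ‖p.1 n‖ :=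
  lp.summable_mul (by simpa using Real.HolderConjugate.two_two) p.2 p.1

variable {H : Type u} [NormedAddCommGroup H] [InnerProductSpace ℂ H]

theorem summable_inner_apply (T : H →L[ℂ] H)
    (p : lp (fun _ : ℕ => H) 2 × lp (fun _ : ℕ => H) 2) :
    Summable fun n => ⟪p.2 n, T (p.1 n)⟫_ℂ :=
  .of_norm_bounded ((summable_norm_mul_norm p).mul_left ‖T‖)
    fun _ => norm_inner_apply_le T le_rfl _ _

variable [CompleteSpace H] {α : Type*} {T : α → H →L[ℂ] H} {l : Filter α} {T₀ : H →L[ℂ] H}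

theorem tendsto_weakStar_iff : Tendsto T l (@nhds _ (weakStar H) T₀) ↔
    ∀ p : lp (fun _ : ℕ => H) 2 × lp (fun _ : ℕ => H) 2,
      Tendsto (fun a => ∑' n, ⟪p.2 n, T a (p.1 n)⟫_ℂ) l (𝓝 (∑' n, ⟪p.2 n, T₀ (p.1 n)⟫_ℂ)) := by
  rw [nhds_induced, tendsto_comap_iff, tendsto_pi_nhds]
  rfl

theorem WTendsto.tendsto_weakStar (h : WTendsto T l T₀) {C : ℝ} (hC : ∀ᶠ a in l, ‖T a‖ ≤ C) :
    Tendsto T l (@nhds _ (weakStar H) T₀) := by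
  refine tendsto_weakStar_iff.2 fun p => tendsto_tsum_of_dominated_convergence
    ((summable_norm_mul_norm p).mul_left C) (fun n => h _ _) ?_
  filter_upwards [hC] with a ha n using norm_inner_apply_le _ ha _ _

theorem wTendsto_of_tendsto_weakStar (h : Tendsto T l (@nhds _ (weakStar H) T₀)) :
    WTendsto T l T₀ := by
  intro η ξ
  have single_pairing : ∀ S : H →L[ℂ] H, ∑' n, ⟪(lp.single (E := fun _ : ℕ => H) 2 0 η) n,
      S ((lp.single (E := fun _ : ℕ => H) 2 0 ξ) n)⟫_ℂ = ⟪η, S ξ⟫_ℂ := fun S => by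
    rw [tsum_eq_single 0 fun n hn => by simp [hn]]
    simp
  simpa only [single_pairing] using tendsto_weakStar_iff.1 h (lp.single 2 0 ξ, lp.single 2 0 η)

end WeakStar

/-! ## Accretive operator matrices -/

section AccretiveMatrices

variable {H : Type u} [NormedAddCommGroup H] [InnerProductSpace ℂ H]

/-- The operator matrix `a` has accretive quadratic form; for square matrices indexed by `Fin n`
this says that `matOp a` is real positive. -/
def IsAccretiveMatrix {ι : Type*} [Fintype ι] (a : ι → ι → H →L[ℂ] H) : Prop :=
  ∀ v : ι → H, 0 ≤ (∑ i, ∑ j, ⟪v i, a i j (v j)⟫_ℂ).re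

/-- Real complete positivity of a linear map on all of `B(H)`. -/
def IsRCP (Ψ : (H →L[ℂ] H) →ₗ[ℂ] (H →L[ℂ] H)) : Prop :=
  ∀ (n : ℕ) (a : Fin n → Fin n → H →L[ℂ] H),
    IsAccretiveMatrix a → IsAccretiveMatrix fun i j => Ψ (a i j)

theorem IsAccretiveMatrix.reindex {ι κ : Type*} [Fintype ι] [Fintype κ] {a : ι → ι → H →L[ℂ] H}
    (ha : IsAccretiveMatrix a) (e : κ ≃ ι) : IsAccretiveMatrix fun i j => a (e i) (e j) := by
  intro v
  simpa [← e.sum_comp] using ha (v ∘ e.symm)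

theorem IsRCP.isAccretiveMatrix {Ψ : (H →L[ℂ] H) →ₗ[ℂ] (H →L[ℂ] H)} (hΨ : IsRCP Ψ)
    {ι : Type*} [Fintype ι] {a : ι → ι → H →L[ℂ] H} (ha : IsAccretiveMatrix a) :
    IsAccretiveMatrix fun i j => Ψ (a i j) := by
  let e := Fintype.equivFin ι
  simpa using (hΨ _ _ (ha.reindex e.symm)).reindex e

variable [CompleteSpace H]

theorem isRealPositive_iff (T : H →L[ℂ] H) :
    IsRealPositive T ↔ ∀ v, 0 ≤ (⟪v, T v⟫_ℂ).re := by
  have quadratic_form (v : H) :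
      (T + ContinuousLinearMap.adjoint T).reApplyInnerSelf v = 2 * (⟪v, T v⟫_ℂ).re := by
    rw [ContinuousLinearMap.reApplyInnerSelf_apply, add_apply, inner_add_left,
      ContinuousLinearMap.adjoint_inner_left, map_add, inner_re_symm (T v) v]
    exact (two_mul _).symm
  have self_adjoint : IsSelfAdjoint (T + ContinuousLinearMap.adjoint T) :=
    IsSelfAdjoint.add_star_self T
  simp only [IsRealPositive, ContinuousLinearMap.isPositive_def', self_adjoint, true_and,
    quadratic_form, Nat.ofNat_pos, mul_nonneg_iff_of_pos_left]

theorem isRealPositive_subMatOp_iff {S : Submodule ℂ (H →L[ℂ] H)} {n : ℕ}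
    (a : Matrix (Fin n) (Fin n) S) :
    IsRealPositive (subMatOp S a) ↔ IsAccretiveMatrix fun i j => (a i j : H →L[ℂ] H) := by
  have quadratic_form (v : PiLp 2 fun _ : Fin n => H) : ⟪v, subMatOp S a v⟫_ℂ
      = ∑ i, ∑ j, ⟪v i, (a i j : H →L[ℂ] H) (v j)⟫_ℂ := by
    simp only [PiLp.inner_apply, subMatOp, matOp_apply, inner_sum, Matrix.map_apply]
  simp only [isRealPositive_iff, quadratic_form]
  exact (WithLp.equiv 2 (Fin n → H)).forall_congr_left

theorem IsRealCompletelyPositive.isAccretiveMatrix {S : Submodule ℂ (H →L[ℂ] H)} {T : S →ₗ[ℂ] S}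
    (hT : IsRealCompletelyPositive T) {ι : Type*} [Fintype ι] {a : ι → ι → S}
    (ha : IsAccretiveMatrix fun i j => (a i j : H →L[ℂ] H)) :
    IsAccretiveMatrix fun i j => (T (a i j) : H →L[ℂ] H) := by
  let e := Fintype.equivFin ι
  have h := hT _ (Matrix.of fun i j => a (e.symm i) (e.symm j))
    ((isRealPositive_subMatOp_iff _).2 (ha.reindex e.symm))
  rw [isRealPositive_subMatOp_iff] at h
  simpa using h.reindex e

theorem norm_matOp_le_iff {n : ℕ} (a : Matrix (Fin n) (Fin n) (H →L[ℂ] H)) {C : ℝ} (hC : 0 ≤ C) :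
    ‖matOp a‖ ≤ C ↔ ∀ v : Fin n → H, ∑ i, ‖∑ j, a i j (v j)‖ ^ 2 ≤ C ^ 2 * ∑ j, ‖v j‖ ^ 2 := by
  have norm_apply_le (v : PiLp 2 fun _ : Fin n => H) : ‖matOp a v‖ ≤ C * ‖v‖ ↔
      ∑ i, ‖∑ j, a i j (v j)‖ ^ 2 ≤ C ^ 2 * ∑ j, ‖v j‖ ^ 2 := by
    rw [← sq_le_sq₀ (norm_nonneg _) (by positivity), mul_pow, PiLp.norm_sq_eq_of_L2,
      PiLp.norm_sq_eq_of_L2]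
    simp only [matOp_apply]
  simp only [ContinuousLinearMap.opNorm_le_iff hC, norm_apply_le]
  exact (WithLp.equiv 2 (Fin n → H)).forall_congr_left

end AccretiveMatrices

/-! ## Arveson's extension theorem -/

section QuadraticForms

variable {H : Type u} [NormedAddCommGroup H] [InnerProductSpace ℂ H]

/-- The vector functional `b ↦ ⟪η, b ξ⟫` on `B(H)`. -/
def vecFunctional (η ξ : H) : (H →L[ℂ] H) →ₗ[ℂ] ℂ where
  toFun b := ⟪η, b ξ⟫_ℂ
  map_add' b b' := by simp
  map_smul' c b := by simp

/-- A finitely supported `c : H × H →₀ B(H)` is regarded as an operator matrix with rows and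
columns indexed by `H`. This is the quadratic form of its amplification `T c` at the vectors
`v ·`, that is, `∑ ⟪v η, T (c (η, ξ)) (v ξ)⟫`. -/
def quadForm (T : (H →L[ℂ] H) →ₗ[ℂ] (H →L[ℂ] H)) (v : H → H) :
    (H × H →₀ (H →L[ℂ] H)) →ₗ[ℂ] ℂ :=
  Finsupp.lsum ℂ fun p => vecFunctional (v p.1) (v p.2) ∘ₗ T

@[simp]
theorem quadForm_single (T : (H →L[ℂ] H) →ₗ[ℂ] (H →L[ℂ] H)) (v : H → H) (η ξ : H)
    (b : H →L[ℂ] H) :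
    quadForm T v (Finsupp.single (η, ξ) b) = ⟪v η, T b (v ξ)⟫_ℂ := by
  simp [quadForm, vecFunctional]

theorem quadForm_congr (T : (H →L[ℂ] H) →ₗ[ℂ] (H →L[ℂ] H)) {v w : H → H}
    {c : H × H →₀ (H →L[ℂ] H)}
    (h : ∀ p ∈ c.support, v p.1 = w p.1 ∧ v p.2 = w p.2) : quadForm T v c = quadForm T w c := by
  rw [quadForm, quadForm, Finsupp.lsum_apply, Finsupp.lsum_apply]
  exact Finsupp.sum_congr fun p hp => by rw [(h p hp).1, (h p hp).2]

/-- The matrix `X* c X`, where the row of `X` at `η` is `φ η`. -/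
def compression {ι : Type*} (φ : H → ι → ℂ) (k l : ι) :
    (H × H →₀ (H →L[ℂ] H)) →ₗ[ℂ] (H →L[ℂ] H) :=
  Finsupp.lsum ℂ fun p => (conj (φ p.1 k) * φ p.2 l) • LinearMap.id

theorem compression_mem {ι : Type*} {M : Submodule ℂ (H →L[ℂ] H)} (φ : H → ι → ℂ) (k l : ι)
    {c : H × H →₀ (H →L[ℂ] H)} (hc : ∀ p, c p ∈ M) : compression φ k l c ∈ M := by
  rw [compression, Finsupp.lsum_apply]
  exact Submodule.sum_mem _ fun p _ => M.smul_mem _ (hc p)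

theorem sum_inner_compression {ι : Type*} [Fintype ι] (T : (H →L[ℂ] H) →ₗ[ℂ] (H →L[ℂ] H))
    (φ : H → ι → ℂ) (w : ι → H) (c : H × H →₀ (H →L[ℂ] H)) :
    ∑ k, ∑ l, ⟪w k, T (compression φ k l c) (w l)⟫_ℂ
      = quadForm T (fun x => ∑ k, φ x k • w k) c := by
  induction c using Finsupp.induction_linear with
  | zero => simp
  | add c c' h h' => simp only [map_add, add_apply, inner_add_right, Finset.sum_add_distrib, h, h']
  | single p b =>
    obtain ⟨η, ξ⟩ := p
    simp only [compression, Finsupp.lsum_single, LinearMap.smul_apply, LinearMap.id_apply, map_smul,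
      map_sum, smul_apply, inner_smul_right, quadForm_single, sum_inner, inner_sum,
      inner_smul_left, Finset.mul_sum, mul_assoc]
    rw [Finset.sum_comm]
    simp only [mul_left_comm]

/-- The finitely supported operator matrices, indexed by `H`, whose quadratic form is accretive at
the linear families of vectors in the range of the idempotent `e`. Since only linear families are
tested, functionals that are positive on this cone are automatically sesquilinear in the indices;
see `eq_of_quadForm_eq`. -/
def accretiveCone (e : H →L[ℂ] H) : PointedCone ℝ (H × H →₀ (H →L[ℂ] H)) where
  carrier := {c | ∀ v : H →ₗ[ℂ] H, (∀ x, e (v x) = v x) → 0 ≤ (quadForm LinearMap.id v c).re}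
  add_mem' h h' v hv := by simpa using add_nonneg (h v hv) (h' v hv)
  zero_mem' v _ := by simp
  smul_mem' r c h v hv := by
    change 0 ≤ (quadForm LinearMap.id v ((r : ℝ) • c)).re
    rw [LinearMap.map_smul_of_tower, Complex.smul_re]
    exact mul_nonneg r.2 (h v hv)

theorem re_inner_le_norm_mul (b : H →L[ℂ] H) (η ξ : H) :
    2 * (⟪η, b ξ⟫_ℂ).re ≤ ‖b‖ * (‖η‖ ^ 2 + ‖ξ‖ ^ 2) := by
  have bound : (⟪η, b ξ⟫_ℂ).re ≤ ‖b‖ * (‖η‖ * ‖ξ‖) :=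
    (Complex.re_le_norm _).trans (norm_inner_apply_le b le_rfl η ξ)
  nlinarith [mul_nonneg (norm_nonneg b) (sq_nonneg (‖η‖ - ‖ξ‖))]

theorem exists_add_mem_accretiveCone {M : Submodule ℂ (H →L[ℂ] H)} {e : H →L[ℂ] H} (he : e ∈ M)
    (y : H × H →₀ (H →L[ℂ] H)) :
    ∃ x : H × H →₀ (H →L[ℂ] H), (∀ p, x p ∈ M) ∧ x + y ∈ accretiveCone e := by
  induction y using Finsupp.induction_linear with
  | zero => exact ⟨0, by simp, by simp⟩
  | add y y' h h' =>
    obtain ⟨x, hx, hxy⟩ := h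
    obtain ⟨x', hx', hxy'⟩ := h'
    exact ⟨x + x', fun p => M.add_mem (hx p) (hx' p), by
      simpa only [add_add_add_comm] using add_mem hxy hxy'⟩
  | single p b =>
    classical
    obtain ⟨η, ξ⟩ := p
    refine ⟨Finsupp.single (η, η) ((‖b‖ : ℂ) • e) + Finsupp.single (ξ, ξ) ((‖b‖ : ℂ) • e),
      fun p => ?_, fun v hv => ?_⟩
    · rw [Finsupp.add_apply, Finsupp.single_apply, Finsupp.single_apply]
      refine M.add_mem ?_ ?_ <;> split_ifs <;> first | exact M.smul_mem _ he | exact M.zero_mem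
    · have bound := re_inner_le_norm_mul (-b) (v η) (v ξ)
      have := mul_nonneg (norm_nonneg b) (add_nonneg (sq_nonneg ‖v η‖) (sq_nonneg ‖v ξ‖))
      simp [hv, ← Complex.ofReal_pow, inner_self_eq_norm_sq_to_K] at bound ⊢
      linarith

end QuadraticForms

section PositiveFunctionals

variable {H : Type u} [NormedAddCommGroup H] [InnerProductSpace ℂ H] {e : H →L[ℂ] H}
  {G : (H × H →₀ (H →L[ℂ] H)) →ₗ[ℂ] ℂ}

theorem eq_of_quadForm_eq (hG : ∀ c ∈ accretiveCone e, 0 ≤ (G c).re)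
    {c d : H × H →₀ (H →L[ℂ] H)}
    (h : ∀ v : H →ₗ[ℂ] H, (∀ x, e (v x) = v x) →
      quadForm LinearMap.id v c = quadForm LinearMap.id v d) : G c = G d := by
  have re_mul_nonneg (z : ℂ) : 0 ≤ (z * G (c - d)).re := by
    rw [← smul_eq_mul, ← map_smul]
    exact hG _ fun v hv => by simp [h v hv]
  have neg_normSq_nonneg := re_mul_nonneg (-conj (G (c - d)))
  rw [neg_mul, ← Complex.normSq_eq_conj_mul_self, Complex.neg_re, Complex.ofReal_re,
    neg_nonneg] at neg_normSq_nonneg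
  rw [← sub_eq_zero, ← map_sub, ← Complex.normSq_eq_zero]
  exact neg_normSq_nonneg.antisymm (Complex.normSq_nonneg _)

theorem re_apply_single_le (hG : ∀ c ∈ accretiveCone e, 0 ≤ (G c).re)
    (hone : ∀ η, (G (Finsupp.single (η, η) 1)).re ≤ ‖η‖ ^ 2) (b : H →L[ℂ] H) {η ξ : H}
    (hη : ‖η‖ = 1) (hξ : ‖ξ‖ = 1) : (G (Finsupp.single (η, ξ) b)).re ≤ ‖b‖ := by
  have mem_cone : Finsupp.single (η, η) ((‖b‖ : ℂ) • 1) + Finsupp.single (ξ, ξ) ((‖b‖ : ℂ) • 1)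
      - Finsupp.single (η, ξ) ((2 : ℂ) • b) ∈ accretiveCone e := fun v _ => by
    have := re_inner_le_norm_mul b (v η) (v ξ)
    simp [← Complex.ofReal_pow, inner_self_eq_norm_sq_to_K]
    linarith
  have nonneg := hG _ mem_cone
  simp only [← Finsupp.smul_single, map_sub, map_add, map_smul, smul_eq_mul, Complex.sub_re,
    Complex.add_re, Complex.re_ofReal_mul] at nonneg
  have hη₁ := mul_le_mul_of_nonneg_left (hone η) (norm_nonneg b)
  have hξ₁ := mul_le_mul_of_nonneg_left (hone ξ) (norm_nonneg b)
  simp [hη, hξ] at hη₁ hξ₁ nonneg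
  linarith

/-- The sesquilinear form `(η, ξ) ↦ G (single (η, ξ) b)` of a functional `G` that is positive on
the accretive cone, as a linear function of `b`. -/
def sesquilinearOfPositive (hG : ∀ c ∈ accretiveCone e, 0 ≤ (G c).re) (b : H →L[ℂ] H) :
    H →ₗ⋆[ℂ] H →ₗ[ℂ] ℂ :=
  LinearMap.mk₂'ₛₗ (starRingEnd ℂ) (RingHom.id ℂ) (fun η ξ => G (Finsupp.single (η, ξ) b))
    (fun η η' ξ => by
      rw [← map_add]
      exact eq_of_quadForm_eq hG fun v _ => by simp)
    (fun z η ξ => by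
      rw [← map_smul]
      exact eq_of_quadForm_eq hG fun v _ => by simp [mul_comm])
    (fun η ξ ξ' => by
      rw [← map_add]
      exact eq_of_quadForm_eq hG fun v _ => by simp)
    (fun z η ξ => by
      rw [← map_smul]
      exact eq_of_quadForm_eq hG fun v _ => by simp)

theorem norm_sesquilinear_le_of_unit (B : H →ₗ⋆[ℂ] H →ₗ[ℂ] ℂ) {C : ℝ}
    (h : ∀ η ξ, ‖η‖ = 1 → ‖ξ‖ = 1 → ‖B η ξ‖ ≤ C) (η ξ : H) : ‖B η ξ‖ ≤ C * ‖η‖ * ‖ξ‖ := by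
  rcases eq_or_ne η 0 with rfl | hη
  · simp
  rcases eq_or_ne ξ 0 with rfl | hξ
  · simp
  have bound := h ((‖η‖⁻¹ : ℂ) • η) ((‖ξ‖⁻¹ : ℂ) • ξ) (norm_smul_inv_norm hη)
    (norm_smul_inv_norm hξ)
  simp only [map_smulₛₗ, LinearMap.smul_apply, smul_eq_mul, norm_mul, RingHom.id_apply,
    RCLike.norm_conj, norm_inv, Complex.norm_real, norm_norm] at bound
  have := norm_pos_iff.2 hη
  have := norm_pos_iff.2 hξ
  field_simp at bound
  linarith

theorem exists_isRCP_of_positive [CompleteSpace H] (hG : ∀ c ∈ accretiveCone e, 0 ≤ (G c).re)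
    (hone : ∀ η, (G (Finsupp.single (η, η) 1)).re ≤ ‖η‖ ^ 2) :
    ∃ Ψ : (H →L[ℂ] H) →ₗ[ℂ] (H →L[ℂ] H), IsRCP Ψ ∧
      ∀ b η ξ, ⟪η, Ψ b ξ⟫_ℂ = G (Finsupp.single (η, ξ) b) := by
  have bound (b : H →L[ℂ] H) (η ξ : H) (hη : ‖η‖ = 1) (hξ : ‖ξ‖ = 1) :
      ‖sesquilinearOfPositive hG b η ξ‖ ≤ ‖b‖ := by
    obtain ⟨z, hz, hzG⟩ := RCLike.exists_norm_eq_mul_self (G (Finsupp.single (η, ξ) b))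
    calc ‖G (Finsupp.single (η, ξ) b)‖ = (G (Finsupp.single (η, ξ) (z • b))).re := by
          rw [← Finsupp.smul_single, map_smul, smul_eq_mul, ← hzG]
          simp
      _ ≤ ‖z • b‖ := re_apply_single_le hG hone _ hη hξ
      _ = ‖b‖ := by rw [norm_smul, hz, one_mul]
  choose Ψ _ hΨ using fun b => exists_clm_of_sesquilinear (sesquilinearOfPositive hG b)
    (norm_nonneg b) (norm_sesquilinear_le_of_unit _ (bound b))
  replace hΨ (b : H →L[ℂ] H) (η ξ : H) : ⟪η, Ψ b ξ⟫_ℂ = G (Finsupp.single (η, ξ) b) := hΨ b η ξ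
  refine ⟨{ toFun := Ψ, map_add' := fun b b' => ?_, map_smul' := fun z b => ?_ },
    fun n a ha ξ => ?_, hΨ⟩
  · ext1 ξ
    refine ext_inner_left ℂ fun η => ?_
    simp only [add_apply, inner_add_right, hΨ, Finsupp.single_add, map_add]
  · ext1 ξ
    refine ext_inner_left ℂ fun η => ?_
    simp only [smul_apply, inner_smul_right, hΨ, ← Finsupp.smul_single, map_smul, smul_eq_mul,
      RingHom.id_apply]
  · have mem_cone : ∑ i, ∑ j, Finsupp.single (ξ i, ξ j) (a i j) ∈ accretiveCone e :=
      fun v _ => by simpa using ha fun i => v (ξ i)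
    simpa [hΨ] using hG _ mem_cone

end PositiveFunctionals

section Extension

variable {H : Type u} [NormedAddCommGroup H] [InnerProductSpace ℂ H] [CompleteSpace H]
  {M : Submodule ℂ (H →L[ℂ] H)} {e : H →L[ℂ] H}

theorem inner_apply_unit {b : H →L[ℂ] H} (hes : star e = e) (heb : e * b = b) (hbe : b * e = b)
    (η ξ : H) : ⟪e η, b (e ξ)⟫_ℂ = ⟪η, b ξ⟫_ℂ := by
  rw [← ContinuousLinearMap.adjoint_inner_right, ← ContinuousLinearMap.star_eq_adjoint, hes]
  change ⟪η, (e * (b * e)) ξ⟫_ℂ = _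
  rw [hbe, heb]

theorem re_quadForm_nonneg_of_mem_accretiveCone {P : M →ₗ[ℂ] M}
    (hP : IsRealCompletelyPositive P) (hes : star e = e)
    (hunit : ∀ x ∈ M, e * x = x ∧ x * e = x) (he : e ∈ M)
    {P' : (H →L[ℂ] H) →ₗ[ℂ] (H →L[ℂ] H)} (hP' : ∀ x : M, P' x = P x)
    {c : H × H →₀ (H →L[ℂ] H)} (hcM : ∀ p, c p ∈ M) (hc : c ∈ accretiveCone e) :
    0 ≤ (quadForm P' id c).re := by
  classical
  let W := Submodule.span ℂ
    ((c.support.image Prod.fst ∪ c.support.image Prod.snd : Finset H) : Set H)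
  let f := Module.finBasis ℂ W
  obtain ⟨φ, hφ⟩ := f.equivFun.toLinearMap.exists_extend
  have expand (x : H) (hx : x ∈ W) : ∑ k, φ x k • (f k : H) = x := by
    have hφx : φ x = f.equivFun ⟨x, hx⟩ := LinearMap.congr_fun hφ ⟨x, hx⟩
    simpa only [hφx, Submodule.coe_sum, Submodule.coe_smul] using
      congrArg Subtype.val (f.sum_equivFun ⟨x, hx⟩)
  have support_mem (p : H × H) (hp : p ∈ c.support) : p.1 ∈ W ∧ p.2 ∈ W :=
    ⟨Submodule.subset_span (by simpa using Or.inl ⟨_, by simpa using hp⟩),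
      Submodule.subset_span (by simpa using Or.inr ⟨_, by simpa using hp⟩)⟩
  let d k l : M := ⟨compression φ k l c, compression_mem φ k l hcM⟩
  have accretive : IsAccretiveMatrix fun k l => (d k l : H →L[ℂ] H) := fun w => by
    have at_e (k l) : ⟪w k, (d k l : H →L[ℂ] H) (w l)⟫_ℂ
        = ⟪e (w k), (LinearMap.id : (H →L[ℂ] H) →ₗ[ℂ] _) (compression φ k l c) (e (w l))⟫_ℂ :=
      (inner_apply_unit hes (hunit _ (d k l).2).1 (hunit _ (d k l).2).2 _ _).symm
    simp only [at_e, sum_inner_compression]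
    have he_apply (x : H) : e (e x) = e x := congrArg (· x) (hunit e he).1
    let v : H →ₗ[ℂ] H := ∑ k, (LinearMap.proj k ∘ₗ φ).smulRight (e (w k))
    have v_apply (x : H) : v x = ∑ k, φ x k • e (w k) := by simp [v]
    simpa only [← v_apply] using hc v fun x => by simp [v_apply, he_apply]
  rw [quadForm_congr (w := fun x => ∑ k, φ x k • (f k : H)) P' fun p hp =>
    ⟨(expand _ (support_mem p hp).1).symm, (expand _ (support_mem p hp).2).symm⟩,
    ← sum_inner_compression]
  simpa only [← hP'] using hP.isAccretiveMatrix accretive fun k => (f k : H)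

theorem exists_positive_extension {P : M →ₗ[ℂ] M} (hP : IsRealCompletelyPositive P) (he : e ∈ M)
    (hes : star e = e) (hunit : ∀ x ∈ M, e * x = x ∧ x * e = x) :
    ∃ G : (H × H →₀ (H →L[ℂ] H)) →ₗ[ℂ] ℂ, (∀ c ∈ accretiveCone e, 0 ≤ (G c).re) ∧
      ∀ (x : M) (η ξ : H),
        G (Finsupp.single (η, ξ) (x : H →L[ℂ] H)) = ⟪η, (P x : H →L[ℂ] H) ξ⟫_ℂ := by
  obtain ⟨P', hP'⟩ := (M.subtype ∘ₗ P).exists_extend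
  replace hP' (x : M) : P' x = P x := LinearMap.congr_fun hP' x
  let D := Finsupp.submodule (α := H × H) fun _ => M
  obtain ⟨g, hgD, hg⟩ := riesz_extension (accretiveCone e)
    ((Complex.reLm ∘ₗ (quadForm P' id).restrictScalars ℝ).toPMap (D.restrictScalars ℝ))
    (fun c hc => re_quadForm_nonneg_of_mem_accretiveCone hP hes hunit he hP' c.2 hc)
    (fun y => by
      obtain ⟨x, hx, hxy⟩ := exists_add_mem_accretiveCone he y
      exact ⟨⟨x, hx⟩, hxy⟩)
  let G : (H × H →₀ (H →L[ℂ] H)) →ₗ[ℂ] ℂ := Module.Dual.extendRCLike g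
  have re_G (c) : (G c).re = g c := Module.Dual.re_extendRCLike_apply (𝕜 := ℂ) g c
  have re_G_eq (c) (hc : c ∈ D) : (G c).re = (quadForm P' id c).re := by
    rw [re_G]
    exact hgD ⟨c, hc⟩
  have G_eq (c) (hc : c ∈ D) : G c = quadForm P' id c := by
    refine Complex.ext (re_G_eq c hc) ?_
    simpa using re_G_eq (Complex.I • c) (D.smul_mem _ hc)
  refine ⟨G, by simpa only [re_G] using hg, fun x η ξ => ?_⟩
  have single_mem : Finsupp.single (η, ξ) (x : H →L[ℂ] H) ∈ D := fun p => by
    classical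
    rw [Finsupp.single_apply]
    split_ifs
    exacts [x.2, M.zero_mem]
  rw [G_eq _ single_mem, quadForm_single, hP', id, id]

/-- **Arveson extension** for a subspace whose unit is a projection. -/
theorem exists_isRCP_extension {P : M →ₗ[ℂ] M} (hP : IsRealCompletelyPositive P) (he : e ∈ M)
    (hes : star e = e) (hunit : ∀ x ∈ M, e * x = x ∧ x * e = x) (hPe : ‖P ⟨e, he⟩‖ ≤ 1) :
    ∃ Ψ : (H →L[ℂ] H) →ₗ[ℂ] (H →L[ℂ] H), IsRCP Ψ ∧ (∀ x : M, Ψ x = P x) ∧ Ψ 1 = P ⟨e, he⟩ := by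
  obtain ⟨G, hG, hGM⟩ := exists_positive_extension hP he hes hunit
  have G_one (η ξ : H) :
      G (Finsupp.single (η, ξ) 1) = ⟪η, (P ⟨e, he⟩ : H →L[ℂ] H) ξ⟫_ℂ := by
    rw [← hGM]
    exact eq_of_quadForm_eq hG fun v hv => by simp [hv]
  obtain ⟨Ψ, hΨ, hΨG⟩ := exists_isRCP_of_positive hG
    fun η => G_one η η ▸ re_inner_apply_self_le hPe η
  refine ⟨Ψ, hΨ, fun x => ?_, ?_⟩ <;> ext1 ξ <;> refine ext_inner_left ℂ fun η => ?_
  · rw [hΨG, hGM]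
  · rw [hΨG, G_one]

end Extension

/-! ## The Choi–Effros identity -/

section ChoiEffros

variable {H : Type u} [NormedAddCommGroup H] [InnerProductSpace ℂ H]

theorem eq_zero_of_forall_re_inner_add_nonneg {T : H →L[ℂ] H} (r : H → ℝ)
    (h : ∀ v w, 0 ≤ (⟪v, T w⟫_ℂ).re + r w) : T = 0 := by
  ext w
  by_contra hTw
  have hpos : 0 < ‖T w‖ ^ 2 := by
    have := norm_pos_iff.2 hTw
    positivity
  have self_eq : (⟪T w, T w⟫_ℂ).re = ‖T w‖ ^ 2 := inner_self_eq_norm_sq (𝕜 := ℂ) _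
  have neg_one_nonneg := h (((-((r w + 1) / ‖T w‖ ^ 2) : ℝ) : ℂ) • T w) w
  rw [inner_smul_left, Complex.conj_ofReal, Complex.re_ofReal_mul, self_eq, neg_mul,
    div_mul_cancel₀ _ hpos.ne'] at neg_one_nonneg
  linarith

variable [CompleteSpace H]

theorem re_inner_star_apply (b : H →L[ℂ] H) (η ξ : H) :
    (⟪η, (star b) ξ⟫_ℂ).re = (⟪ξ, b η⟫_ℂ).re := by
  rw [ContinuousLinearMap.star_eq_adjoint, ContinuousLinearMap.adjoint_inner_right]
  exact inner_re_symm (𝕜 := ℂ) _ _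

theorem sum_inner_star_mul {ι : Type*} [Fintype ι] (c : ι → H →L[ℂ] H) (v : ι → H) :
    ∑ i, ∑ j, ⟪v i, (star (c i) * c j) (v j)⟫_ℂ = ⟪∑ i, c i (v i), ∑ i, c i (v i)⟫_ℂ := by
  simp only [sum_inner, inner_sum, mul_apply_eq_comp, ContinuousLinearMap.star_eq_adjoint,
    ContinuousLinearMap.adjoint_inner_right]
  exact Finset.sum_comm

theorem isAccretiveMatrix_star_mul {ι : Type*} [Fintype ι] (c : ι → H →L[ℂ] H) :
    IsAccretiveMatrix fun i j => star (c i) * c j := fun v => by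
  rw [sum_inner_star_mul]
  exact inner_self_nonneg (𝕜 := ℂ)

namespace IsRCP

variable {Ψ : (H →L[ℂ] H) →ₗ[ℂ] (H →L[ℂ] H)}

theorem map_star (hΨ : IsRCP Ψ) (b : H →L[ℂ] H) : Ψ (star b) = star (Ψ b) := by
  have skew : IsAccretiveMatrix ![![0, star b], ![-b, 0]] := fun v => by
    simp [Fin.sum_univ_two, re_inner_star_apply]
  rw [← sub_eq_zero]
  refine eq_zero_of_forall_re_inner_add_nonneg 0 fun v w => ?_
  simpa [Fin.sum_univ_two, inner_sub_right, re_inner_star_apply, ← sub_eq_add_neg] using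
    hΨ.isAccretiveMatrix skew ![v, w]

theorem re_inner_star_mul_le (hΨ : IsRCP Ψ) (h1 : ‖Ψ 1‖ ≤ 1) (c : H →L[ℂ] H) (ξ : H) :
    (⟪ξ, Ψ (star c * c) ξ⟫_ℂ).re ≤ ‖c‖ ^ 2 * ‖ξ‖ ^ 2 := by
  have accretive : IsAccretiveMatrix fun _ _ : Unit =>
      ((‖c‖ ^ 2 : ℝ) : ℂ) • (1 : H →L[ℂ] H) - star c * c := fun v => by
    have apply_le := pow_le_pow_left₀ (norm_nonneg _) (c.le_opNorm (v ())) 2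
    simp [ContinuousLinearMap.star_eq_adjoint, ContinuousLinearMap.adjoint_inner_right,
      inner_self_eq_norm_sq_to_K, ← Complex.ofReal_pow]
    linarith
  have nonneg := hΨ.isAccretiveMatrix accretive fun _ => ξ
  have := mul_le_mul_of_nonneg_left (re_inner_apply_self_le h1 ξ) (sq_nonneg ‖c‖)
  simp only [map_sub, map_smul, Finset.univ_unique, Finset.sum_singleton, sub_apply, smul_apply,
    inner_sub_right, inner_smul_right, Complex.sub_re, Complex.re_ofReal_mul] at nonneg
  linarith

/-- This form of the operator Schwarz inequality is linear in the operators `Ψ (c i)`, hence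
stable under weak limits. -/
theorem schwarz (hΨ : IsRCP Ψ) (h1 : ‖Ψ 1‖ ≤ 1) {ι : Type*} [Fintype ι] (c : ι → H →L[ℂ] H)
    (v : ι → H) (ζ : H) :
    0 ≤ ‖ζ‖ ^ 2 + 2 * (∑ i, ⟪ζ, Ψ (c i) (v i)⟫_ℂ).re +
      (∑ i, ∑ j, ⟪v i, Ψ (star (c i) * c j) (v j)⟫_ℂ).re := by
  have nonneg := hΨ.isAccretiveMatrix (isAccretiveMatrix_star_mul fun o : Option ι => o.elim 1 c)
    fun o => o.elim ζ v
  have := re_inner_apply_self_le h1 ζ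
  simp [Fintype.sum_option, Finset.sum_add_distrib, hΨ.map_star, re_inner_star_apply] at nonneg ⊢
  linarith

theorem isAccretiveMatrix_sub_of_wTendsto (hΨ : IsRCP Ψ) (h1 : ‖Ψ 1‖ ≤ 1)
    {ι α : Type*} [Fintype ι] {l : Filter α} [l.NeBot] {c : α → ι → H →L[ℂ] H}
    {y : ι → H →L[ℂ] H} {s : ι → ι → H →L[ℂ] H}
    (hy : ∀ i, WTendsto (fun t => Ψ (c t i)) l (y i))
    (hs : ∀ i j, WTendsto (fun t => Ψ (star (c t i) * c t j)) l (s i j)) :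
    IsAccretiveMatrix fun i j => s i j - star (y i) * y j := fun v => by
  set ζ := -∑ i, y i (v i) with hζ
  have lim : 0 ≤ ‖ζ‖ ^ 2 + 2 * (∑ i, ⟪ζ, y i (v i)⟫_ℂ).re
      + (∑ i, ∑ j, ⟪v i, s i j (v j)⟫_ℂ).re := by
    refine ge_of_tendsto ((((Complex.continuous_re.tendsto _).comp
      (tendsto_finsetSum _ fun i _ => hy i ζ (v i))).const_mul 2).const_add (‖ζ‖ ^ 2) |>.add
      ((Complex.continuous_re.tendsto _).comp (tendsto_finsetSum _ fun i _ =>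
        tendsto_finsetSum _ fun j _ => hs i j (v i) (v j))))
      (Eventually.of_forall fun t => hΨ.schwarz h1 (c t) v ζ)
  have self_eq : (⟪ζ, ζ⟫_ℂ).re = ‖ζ‖ ^ 2 := inner_self_eq_norm_sq (𝕜 := ℂ) _
  have cross : ∑ i, ⟪ζ, y i (v i)⟫_ℂ = -⟪ζ, ζ⟫_ℂ := by
    rw [← inner_sum, ← inner_neg_right, hζ, neg_neg]
  rw [cross, Complex.neg_re, self_eq] at lim
  simp only [sub_apply, inner_sub_right, Finset.sum_sub_distrib, sum_inner_star_mul,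
    Complex.sub_re]
  rw [← inner_neg_neg, ← hζ, self_eq]
  linarith

theorem norm_map_le (hΨ : IsRCP Ψ) (h1 : ‖Ψ 1‖ ≤ 1) (c : H →L[ℂ] H) : ‖Ψ c‖ ≤ ‖c‖ := by
  refine (Ψ c).opNorm_le_bound (norm_nonneg _) fun ξ => le_of_sq_le_sq ?_ (by positivity)
  have nonneg := hΨ.isAccretiveMatrix_sub_of_wTendsto h1 (ι := Unit) (l := (pure () : Filter Unit))
    (fun _ => wTendsto_const (Ψ c) _) (fun _ _ => wTendsto_const (Ψ (star c * c)) _) fun _ => ξ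
  calc ‖Ψ c ξ‖ ^ 2 ≤ (⟪ξ, Ψ (star c * c) ξ⟫_ℂ).re := by
        simpa [ContinuousLinearMap.star_eq_adjoint, ContinuousLinearMap.adjoint_inner_right,
          inner_self_eq_norm_sq_to_K, ← Complex.ofReal_pow] using nonneg
    _ ≤ ‖c‖ ^ 2 * ‖ξ‖ ^ 2 := hΨ.re_inner_star_mul_le h1 c ξ
    _ = (‖c‖ * ‖ξ‖) ^ 2 := (mul_pow _ _ _).symm

theorem map_eq_zero_of_isAccretiveMatrix (hΨ : IsRCP Ψ) {a b c d : H →L[ℂ] H}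
    (h : IsAccretiveMatrix ![![a, b], ![c, d]]) (ha : Ψ a = 0) (hc : c = star b) : Ψ b = 0 := by
  refine eq_zero_of_forall_re_inner_add_nonneg (fun w => (⟪w, Ψ d w⟫_ℂ).re / 2) fun v w => ?_
  have nonneg := hΨ.isAccretiveMatrix h ![v, w]
  simp [Fin.sum_univ_two, ha, hc, hΨ.map_star, re_inner_star_apply] at nonneg
  linarith

theorem map_eq_of_wTendsto (hΨ : IsRCP Ψ) (h1 : ‖Ψ 1‖ ≤ 1) (hid : ∀ b, Ψ (Ψ b) = Ψ b)
    {a : H →L[ℂ] H} (ha : Ψ a = a) {α : Type*} (𝒰 : Ultrafilter α) {y : α → H →L[ℂ] H} {C : ℝ}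
    (hC : ∀ᶠ t in (𝒰 : Filter α), ‖y t‖ ≤ C) {y₀ z : H →L[ℂ] H}
    (hy : WTendsto (fun t => Ψ (y t)) 𝒰 y₀) (hz : WTendsto (fun t => Ψ (a * y t)) 𝒰 z) :
    Ψ z = Ψ (a * y₀) := by
  obtain ⟨s, -, hs⟩ := exists_wTendsto 𝒰 (fun t => Ψ (star (y t) * y t)) (C := C ^ 2) <| by
    filter_upwards [hC] with t ht
    calc ‖Ψ (star (y t) * y t)‖ ≤ ‖star (y t) * y t‖ := hΨ.norm_map_le h1 _
      _ = ‖y t‖ ^ 2 := by rw [CStarRing.norm_star_mul_self, sq]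
      _ ≤ C ^ 2 := by gcongr
  have hz' : WTendsto (fun t => Ψ (star (y t) * star a)) 𝒰 (star z) := by
    simpa only [← hΨ.map_star, star_mul] using hz.star
  have has : Ψ (star a) = star a := by rw [hΨ.map_star, ha]
  have accretive := hΨ.isAccretiveMatrix_sub_of_wTendsto h1 (c := fun t => ![star a, y t])
    (y := ![star a, y₀]) (s := ![![Ψ (a * star a), z], ![star z, s]]) (l := 𝒰)
    (by simpa [Fin.forall_fin_two, has] using ⟨wTendsto_const _ _, hy⟩)
    (by simpa [Fin.forall_fin_two] using ⟨⟨wTendsto_const _ _, hz⟩, hz', hs⟩)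
  rw [← sub_eq_zero, ← map_sub]
  refine hΨ.map_eq_zero_of_isAccretiveMatrix (a := Ψ (a * star a) - a * star a)
    (c := star z - star y₀ * star a) (d := s - star y₀ * y₀) ?_ (by simp [hid]) (by simp)
  convert accretive using 1
  funext i j
  fin_cases i <;> fin_cases j <;> simp

theorem map_mul_map (hΨ : IsRCP Ψ) (h1 : ‖Ψ 1‖ ≤ 1) (hid : ∀ b, Ψ (Ψ b) = Ψ b)
    {a : H →L[ℂ] H} (ha : Ψ a = a) (b : H →L[ℂ] H) : Ψ (a * Ψ b) = Ψ (a * b) := by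
  have := hΨ.map_eq_of_wTendsto h1 hid ha (pure () : Ultrafilter Unit) (y := fun _ => b)
    (C := ‖b‖) (Eventually.of_forall fun _ => le_rfl) (wTendsto_const _ _) (wTendsto_const _ _)
  rw [← this, hid]

theorem map_map_mul (hΨ : IsRCP Ψ) (h1 : ‖Ψ 1‖ ≤ 1) (hid : ∀ b, Ψ (Ψ b) = Ψ b)
    {a : H →L[ℂ] H} (ha : Ψ a = a) (b : H →L[ℂ] H) : Ψ (Ψ b * a) = Ψ (b * a) := by
  have := hΨ.map_mul_map h1 hid (a := star a) (by rw [hΨ.map_star, ha]) (star b)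
  rw [hΨ.map_star, ← star_mul, ← star_mul, hΨ.map_star, hΨ.map_star] at this
  exact star_injective this

end IsRCP

end ChoiEffros

section IdempotentExtension

variable {H : Type u} [NormedAddCommGroup H] [InnerProductSpace ℂ H]

theorem IsRCP.of_wTendsto {α : Type*} {l : Filter α} [l.NeBot]
    {Ψ : α → (H →L[ℂ] H) →ₗ[ℂ] (H →L[ℂ] H)} {Θ : (H →L[ℂ] H) →ₗ[ℂ] (H →L[ℂ] H)}
    (hΨ : ∀ t, IsRCP (Ψ t)) (h : ∀ b, WTendsto (fun t => Ψ t b) l (Θ b)) : IsRCP Θ :=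
  fun n a ha v => ge_of_tendsto ((Complex.continuous_re.tendsto _).comp
    (tendsto_finsetSum _ fun i _ => tendsto_finsetSum _ fun j _ => h (a i j) (v i) (v j)))
    (Eventually.of_forall fun t => hΨ t n a ha v)

/-- The real completely positive maps on `B(H)` that extend `P` and take the value `p` at the
identity operator. For idempotent `P` and `p` in its range they form a semigroup under composition,
compact in the point-weak topology, so Ellis' theorem provides an idempotent among them. -/
def rcpExtensions {M : Submodule ℂ (H →L[ℂ] H)} (P : M →ₗ[ℂ] M) (p : M) :
    Set ((H →L[ℂ] H) →ₗ[ℂ] (H →L[ℂ] H)) :=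
  {Ψ | IsRCP Ψ ∧ (∀ x : M, Ψ x = P x) ∧ Ψ 1 = p}

variable {M : Submodule ℂ (H →L[ℂ] H)} {P : M →ₗ[ℂ] M} {p : M}

theorem comp_mem_rcpExtensions (hPP : P ∘ₗ P = P) (hp : P p = p)
    {Ψ Θ : (H →L[ℂ] H) →ₗ[ℂ] (H →L[ℂ] H)} (hΨ : Ψ ∈ rcpExtensions P p)
    (hΘ : Θ ∈ rcpExtensions P p) : Ψ ∘ₗ Θ ∈ rcpExtensions P p := by
  refine ⟨fun n a ha => hΨ.1 n _ (hΘ.1 n a ha), fun x => ?_, ?_⟩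
  · rw [LinearMap.comp_apply, hΘ.2.1, hΨ.2.1, ← LinearMap.comp_apply, hPP]
  · rw [LinearMap.comp_apply, hΘ.2.2, hΨ.2.1, hp]

variable [CompleteSpace H]

theorem exists_mem_rcpExtensions_wTendsto (hp : ‖p‖ ≤ 1) (𝒰 : Ultrafilter (rcpExtensions P p)) :
    ∃ Θ ∈ rcpExtensions P p,
      ∀ b, WTendsto (fun Ψ : rcpExtensions P p => Ψ.1 b) 𝒰 (Θ b) := by
  obtain ⟨Θ, hΘ⟩ := exists_linearMap_wTendsto 𝒰 (fun Ψ : rcpExtensions P p => Ψ.1)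
    (C := fun b => ‖b‖)
    fun b => Eventually.of_forall fun Ψ => Ψ.2.1.norm_map_le (by rw [Ψ.2.2.2]; exact hp) b
  refine ⟨Θ, ⟨.of_wTendsto (fun Ψ => Ψ.2.1) hΘ, fun x => (hΘ x).unique ?_, (hΘ 1).unique ?_⟩, hΘ⟩
  · simpa only [fun Ψ : rcpExtensions P p => Ψ.2.2.1 x] using wTendsto_const _ _
  · simpa only [fun Ψ : rcpExtensions P p => Ψ.2.2.2] using wTendsto_const _ _

theorem exists_idempotent_mem_rcpExtensions (hPP : P ∘ₗ P = P) (hPp : P p = p) (hp : ‖p‖ ≤ 1)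
    (hne : (rcpExtensions P p).Nonempty) : ∃ Q ∈ rcpExtensions P p, Q ∘ₗ Q = Q := by
  let E := rcpExtensions P p
  let _ : Semigroup E :=
    { mul := fun Ψ Θ => ⟨Ψ.1 ∘ₗ Θ.1, comp_mem_rcpExtensions hPP hPp Ψ.2 Θ.2⟩
      mul_assoc := fun _ _ _ => rfl }
  let φ : E → ((H →L[ℂ] H) × H × H → ℂ) := fun Ψ q => ⟪q.2.1, Ψ.1 q.1 q.2.2⟫_ℂ
  let _ : TopologicalSpace E := .induced φ Pi.topologicalSpace
  have φ_inducing : Topology.IsInducing φ := ⟨rfl⟩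
  have φ_injective : Function.Injective φ := fun Ψ Θ h => Subtype.ext <| LinearMap.ext fun b =>
    ContinuousLinearMap.ext fun ξ => ext_inner_left ℂ fun η => congrFun h (b, η, ξ)
  have : T2Space E := T2Space.of_injective_continuous φ_injective φ_inducing.continuous
  have : Nonempty E := hne.to_subtype
  have : CompactSpace E := by
    rw [← isCompact_univ_iff, isCompact_iff_ultrafilter_le_nhds]
    intro 𝒰 _
    obtain ⟨Θ, hΘE, hΘ⟩ := exists_mem_rcpExtensions_wTendsto hp 𝒰
    refine ⟨⟨Θ, hΘE⟩, trivial, ?_⟩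
    rw [φ_inducing.nhds_eq_comap, ← tendsto_iff_comap, tendsto_pi_nhds]
    exact fun q => hΘ q.1 q.2.1 q.2.2
  obtain ⟨Q, hQ⟩ := exists_idempotent_of_compact_t2_of_continuous_mul_left (M := E) fun Θ => by
    rw [φ_inducing.continuous_iff, continuous_pi_iff]
    exact fun q => (continuous_apply (Θ.1 q.1, q.2.1, q.2.2)).comp φ_inducing.continuous
  exact ⟨Q, Q.2, congrArg Subtype.val hQ⟩

theorem exists_idempotent_isRCP_extension (hP : IsRealCompletelyPositive P) (hPP : P ∘ₗ P = P)
    {e : H →L[ℂ] H} (he : e ∈ M) (hes : star e = e)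
    (hunit : ∀ x ∈ M, e * x = x ∧ x * e = x) (hPe : ‖P ⟨e, he⟩‖ ≤ 1) :
    ∃ Q : (H →L[ℂ] H) →ₗ[ℂ] (H →L[ℂ] H), IsRCP Q ∧ (∀ b, Q (Q b) = Q b) ∧
      (∀ x : M, Q x = P x) ∧ Q 1 = P ⟨e, he⟩ := by
  obtain ⟨Q, ⟨hQ, hQP, hQ1⟩, hQQ⟩ := exists_idempotent_mem_rcpExtensions hPP
    (LinearMap.congr_fun hPP ⟨e, he⟩) hPe (exists_isRCP_extension hP he hes hunit hPe)
  exact ⟨Q, hQ, LinearMap.congr_fun hQQ, hQP, hQ1⟩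

end IdempotentExtension

/-! ## Dilation of the Choi–Effros product -/

section Kolmogorov

variable {H : Type u} [NormedAddCommGroup H] [InnerProductSpace ℂ H]

/-- The map on finitely supported families of vectors determined by a family of operators
`j x : H → K`. -/
def synthesis {X K : Type*} [NormedAddCommGroup K] [InnerProductSpace ℂ K] (j : X → H →L[ℂ] K) :
    (X →₀ H) →ₗ[ℂ] K :=
  Finsupp.lsum ℂ fun x => (j x : H →ₗ[ℂ] K)

@[simp] theorem synthesis_single {X K : Type*} [NormedAddCommGroup K] [InnerProductSpace ℂ K]
    (j : X → H →L[ℂ] K) (x : X) (ξ : H) : synthesis j (Finsupp.single x ξ) = j x ξ := by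
  simp [synthesis]

/-- A minimal Kolmogorov decomposition `k x y = (j x)* (j y)` of an operator valued kernel. -/
structure IsKolmogorovDecomposition {X K : Type*} [NormedAddCommGroup K] [InnerProductSpace ℂ K]
    (k : X → X → H →L[ℂ] H) (j : X → H →L[ℂ] K) : Prop where
  inner_apply : ∀ x y ξ η, ⟪j x ξ, j y η⟫_ℂ = ⟪ξ, k x y η⟫_ℂ
  denseRange : DenseRange (synthesis j)

theorem exists_isKolmogorovDecomposition [CompleteSpace H] {X : Type u} (k : X → X → H →L[ℂ] H)
    (hk : ∀ x y, star (k x y) = k y x)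
    (hpos : ∀ s : Finset X, IsAccretiveMatrix fun x y : s => k x y) :
    ∃ (K : Type u) (_ : NormedAddCommGroup K) (_ : InnerProductSpace ℂ K) (_ : CompleteSpace K)
      (j : X → H →L[ℂ] K), IsKolmogorovDecomposition k j := by
  have posSemidef : (Matrix.of k).PosSemidef := by
    have tfae := (RKHS.posSemidef_tfae (K := Matrix.of k)).out 0 2
    refine tfae.2 ⟨Matrix.ext fun x y => hk y x, fun v => ?_⟩
    have nonneg := hpos v.support fun x => v x
    simp only [fun x : v.support => Finset.sum_coe_sort v.support fun y => ⟪v x, k x y (v y)⟫_ℂ,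
      Finset.sum_coe_sort v.support fun x => ∑ y ∈ v.support, ⟪v x, k x y (v y)⟫_ℂ] at nonneg
    rw [Finset.sum_comm, ← Complex.conj_re, map_sum] at nonneg
    simp only [map_sum, inner_conj_symm] at nonneg
    exact nonneg
  have : Fact (Matrix.of k).PosSemidef := ⟨posSemidef⟩
  refine ⟨RKHS.OfKernel (Matrix.of k), inferInstance, inferInstance, inferInstance,
    RKHS.kerFun (RKHS.OfKernel (Matrix.of k)), fun x y ξ η => ?_, ?_⟩
  · rw [← ContinuousLinearMap.adjoint_inner_right, RKHS.adjoint_kerFun, RKHS.kerFun_apply,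
      RKHS.OfKernel.kernel_ofKernel]
    rfl
  · have dense := RKHS.kerFun_dense (RKHS.OfKernel (Matrix.of k))
    rw [← Submodule.dense_iff_topologicalClosure_eq_top] at dense
    refine dense.mono (Submodule.span_le (p := LinearMap.range (synthesis _)).2 ?_)
    rintro _ ⟨x, v, rfl⟩
    exact ⟨Finsupp.single x v, synthesis_single _ _ _⟩

namespace IsKolmogorovDecomposition

variable {X K : Type*} [NormedAddCommGroup K] [InnerProductSpace ℂ K]
  {k : X → X → H →L[ℂ] H} {j : X → H →L[ℂ] K} (hj : IsKolmogorovDecomposition k j)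

include hj

theorem ext_clm {S T : K →L[ℂ] K} (h : ∀ x ξ, S (j x ξ) = T (j x ξ)) : S = T := by
  have h_comp : (S : K →ₗ[ℂ] K) ∘ₗ synthesis j = (T : K →ₗ[ℂ] K) ∘ₗ synthesis j := by
    ext x ξ
    simpa using h x ξ
  exact DFunLike.coe_injective
    (hj.denseRange.equalizer S.continuous T.continuous (congrArg DFunLike.coe h_comp))

theorem ext_vec {v w : K} (h : ∀ x ξ, ⟪j x ξ, v⟫_ℂ = ⟪j x ξ, w⟫_ℂ) : v = w := by
  have h_comp : (innerₛₗ ℂ (v - w)) ∘ₗ synthesis j = 0 := by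
    ext x ξ
    have h_symm : ⟪v, j x ξ⟫_ℂ = ⟪w, j x ξ⟫_ℂ := by
      rw [← inner_conj_symm, h x ξ, inner_conj_symm]
    simp [h_symm]
  have vanish : (fun z : K => ⟪v - w, z⟫_ℂ) = fun _ => 0 :=
    hj.denseRange.equalizer (by fun_prop) continuous_const (congrArg DFunLike.coe h_comp)
  exact sub_eq_zero.1 (inner_self_eq_zero.1 (congrFun vanish (v - w)))

theorem norm_sum_sq {ι : Type*} [Fintype ι] (x : ι → X) (w : ι → H) :
    ‖∑ p, j (x p) (w p)‖ ^ 2 = (∑ p, ∑ q, ⟪w p, k (x p) (x q) (w q)⟫_ℂ).re := by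
  rw [← inner_self_eq_norm_sq (𝕜 := ℂ), sum_inner]
  simp only [inner_sum, hj.inner_apply]
  rfl

theorem apply_add [Add X] (hk : ∀ d x y, k d (x + y) = k d x + k d y) (x y : X) (ξ : H) :
    j (x + y) ξ = j x ξ + j y ξ :=
  hj.ext_vec fun d η => by
    simp only [inner_add_right, hj.inner_apply, hk, add_apply]

theorem apply_smul [SMul ℂ X] (hk : ∀ d (r : ℂ) x, k d (r • x) = r • k d x) (r : ℂ) (x : X)
    (ξ : H) : j (r • x) ξ = r • j x ξ :=
  hj.ext_vec fun d η => by
    simp only [inner_smul_right, hj.inner_apply, hk, smul_apply]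

end IsKolmogorovDecomposition

end Kolmogorov

section Dilation

variable {H : Type u} [NormedAddCommGroup H] [InnerProductSpace ℂ H]
  {Q : (H →L[ℂ] H) →ₗ[ℂ] (H →L[ℂ] H)}

theorem map_coe_range (hid : ∀ b, Q (Q b) = Q b) (x : LinearMap.range Q) : Q x = x := by
  obtain ⟨_, b, rfl⟩ := x
  exact hid b

/-- The Choi–Effros product `(x, y) ↦ Q (x * y)` on the range of `Q`. -/
def choiEffrosMul (Q : (H →L[ℂ] H) →ₗ[ℂ] (H →L[ℂ] H)) (x y : LinearMap.range Q) :
    LinearMap.range Q :=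
  Q.rangeRestrict (x * y)

variable [CompleteSpace H]

theorem re_sum_inner_map_sum_star_mul (T : (H →L[ℂ] H) →ₗ[ℂ] (H →L[ℂ] H)) {κ ι : Type*} [Fintype κ]
    [Fintype ι] (c : κ → ι → H →L[ℂ] H) (v : ι → H) :
    (∑ i, ∑ j, ⟪v i, T (∑ k, star (c k i) * c k j) (v j)⟫_ℂ).re =
      ∑ k, (∑ i, ∑ j, ⟪v i, T (star (c k i) * c k j) (v j)⟫_ℂ).re := by
  rw [← Complex.re_sum]
  simp only [map_sum, sum_apply, inner_sum]
  exact congrArg Complex.re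
    ((Finset.sum_congr rfl fun i _ => Finset.sum_comm).trans Finset.sum_comm)

theorem re_sum_inner_sum_star_mul {κ ι : Type*} [Fintype κ] [Fintype ι] (c : κ → ι → H →L[ℂ] H)
    (v : ι → H) : (∑ i, ∑ j, ⟪v i, (∑ k, star (c k i) * c k j) (v j)⟫_ℂ).re =
      ∑ k, ‖∑ i, c k i (v i)‖ ^ 2 := by
  refine (re_sum_inner_map_sum_star_mul LinearMap.id c v).trans (Finset.sum_congr rfl fun k _ => ?_)
  rw [← inner_self_eq_norm_sq (𝕜 := ℂ), ← sum_inner_star_mul]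
  rfl

theorem IsRCP.sum_re_inner_star_mul_le (hQ : IsRCP Q) {κ κ' ι : Type*} [Fintype κ] [Fintype κ']
    [Fintype ι] {c : κ → ι → H →L[ℂ] H} {d : κ' → ι → H →L[ℂ] H}
    (h : ∀ v : ι → H, ∑ k, ‖∑ i, c k i (v i)‖ ^ 2 ≤ ∑ k, ‖∑ i, d k i (v i)‖ ^ 2) (w : ι → H) :
    ∑ k, (∑ i, ∑ j, ⟪w i, Q (star (c k i) * c k j) (w j)⟫_ℂ).re ≤
      ∑ k, (∑ i, ∑ j, ⟪w i, Q (star (d k i) * d k j) (w j)⟫_ℂ).re := by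
  have accretive : IsAccretiveMatrix fun i j =>
      ∑ k, star (d k i) * d k j - ∑ k, star (c k i) * c k j := fun v => by
    simp only [sub_apply, inner_sub_right, Finset.sum_sub_distrib, Complex.sub_re,
      re_sum_inner_sum_star_mul]
    exact sub_nonneg.2 (h v)
  have nonneg := hQ.isAccretiveMatrix accretive w
  simp only [map_sub, sub_apply, inner_sub_right, Finset.sum_sub_distrib, Complex.sub_re,
    re_sum_inner_map_sum_star_mul] at nonneg
  exact sub_nonneg.1 nonneg

/-- The kernel `(x, y) ↦ Q (x* y)` on the range of `Q`. -/
def choiEffrosKernel (Q : (H →L[ℂ] H) →ₗ[ℂ] (H →L[ℂ] H)) (x y : LinearMap.range Q) : H →L[ℂ] H :=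
  Q (star (x : H →L[ℂ] H) * y)

theorem IsRCP.choiEffrosKernel_mul_mul (hQ : IsRCP Q) (h1 : ‖Q 1‖ ≤ 1) (hid : ∀ b, Q (Q b) = Q b)
    (a b a' b' : LinearMap.range Q) :
    choiEffrosKernel Q (choiEffrosMul Q a b) (choiEffrosMul Q a' b') =
      Q (star ((a : H →L[ℂ] H) * b) * (a' * b')) := by
  have star_mem (x : LinearMap.range Q) : Q (star (x : H →L[ℂ] H)) = star (x : H →L[ℂ] H) := by
    rw [hQ.map_star, map_coe_range hid]
  have absorb {x} (hx : Q x = x) := hQ.map_mul_map h1 hid hx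
  calc Q (star (Q (a * b)) * Q (a' * b')) = Q (star ((a : H →L[ℂ] H) * b) * Q (a' * b')) := by
        rw [← hQ.map_star, hQ.map_map_mul h1 hid (hid _)]
    _ = Q (star (b : H →L[ℂ] H) * Q (star (a : H →L[ℂ] H) * Q (a' * b'))) := by
        rw [star_mul, mul_assoc, absorb (star_mem b)]
    _ = Q (star ((a : H →L[ℂ] H) * b) * (a' * b')) := by
        rw [absorb (star_mem a), absorb (star_mem b), ← mul_assoc, ← star_mul]

namespace IsKolmogorovDecomposition

variable {K : Type u} [NormedAddCommGroup K] [InnerProductSpace ℂ K]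
  {j : LinearMap.range Q → H →L[ℂ] K}
  (hj : IsKolmogorovDecomposition (choiEffrosKernel Q) j)

include hj

theorem choiEffros_add (x y : LinearMap.range Q) (ξ : H) : j (x + y) ξ = j x ξ + j y ξ :=
  hj.apply_add (fun d x y => by simp [choiEffrosKernel, mul_add]) x y ξ

theorem choiEffros_smul (r : ℂ) (x : LinearMap.range Q) (ξ : H) : j (r • x) ξ = r • j x ξ :=
  hj.apply_smul (fun d r x => by simp [choiEffrosKernel]) r x ξ

variable (hQ : IsRCP Q) (h1 : ‖Q 1‖ ≤ 1) (hid : ∀ b, Q (Q b) = Q b)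

include hQ h1 hid

theorem sum_norm_sq_choiEffrosMul_le {κ κ' ι : Type*} [Fintype κ] [Fintype κ'] [Fintype ι]
    {a : κ → ι → LinearMap.range Q} {y : ι → LinearMap.range Q} {d : κ' → ι → LinearMap.range Q}
    (h : ∀ v : ι → H, ∑ k, ‖∑ p, (a k p : H →L[ℂ] H) ((y p : H →L[ℂ] H) (v p))‖ ^ 2 ≤
      ∑ k, ‖∑ p, (d k p : H →L[ℂ] H) (v p)‖ ^ 2) (w : ι → H) :
    ∑ k, ‖∑ p, j (choiEffrosMul Q (a k p) (y p)) (w p)‖ ^ 2 ≤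
      ∑ k, ‖∑ p, j (d k p) (w p)‖ ^ 2 := by
  simp only [hj.norm_sum_sq, hQ.choiEffrosKernel_mul_mul h1 hid]
  exact hQ.sum_re_inner_star_mul_le (c := fun k p => (a k p : H →L[ℂ] H) * y p)
    (d := fun k p => (d k p : H →L[ℂ] H)) h w

theorem sum_norm_sq_synthesis_choiEffrosMul_le {n : ℕ}
    (a : Matrix (Fin n) (Fin n) (LinearMap.range Q)) (f : Fin n → LinearMap.range Q →₀ H) :
    ∑ i, ‖∑ l, synthesis (fun b => j (choiEffrosMul Q (a i l) b)) (f l)‖ ^ 2 ≤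
      ‖subMatOp _ a‖ ^ 2 * ∑ l, ‖synthesis j (f l)‖ ^ 2 := by
  classical
  let C := ‖subMatOp _ a‖
  let s : Finset (LinearMap.range Q) := Finset.univ.biUnion fun l => (f l).support
  have synthesis_eq_sum (g : LinearMap.range Q → H →L[ℂ] K) (l) :
      synthesis g (f l) = ∑ x : s, g x (f l x) := by
    have support_subset : (f l).support ⊆ s :=
      Finset.subset_biUnion_of_mem (fun l => (f l).support) (Finset.mem_univ l)
    rw [synthesis, Finsupp.lsum_apply, Finsupp.sum_of_support_subset _ support_subset _
      (fun _ _ => map_zero _)]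
    exact (Finset.sum_coe_sort s fun x => g x (f l x)).symm
  have sum_single {E : Type u} [NormedAddCommGroup E] [InnerProductSpace ℂ E]
      (g : Fin n × s → E) (l) :
      ∑ p, (if p.1 = l then (C : ℂ) else 0) • g p = (C : ℂ) • ∑ x, g (l, x) := by
    rw [Fintype.sum_prod_type, Finset.sum_comm]
    simp [ite_smul, Finset.smul_sum]
  have norm_sq_smul {E : Type u} [NormedAddCommGroup E] [InnerProductSpace ℂ E] (z : E) :
      ‖(C : ℂ) • z‖ ^ 2 = C ^ 2 * ‖z‖ ^ 2 := by
    simp [norm_smul, mul_pow]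
  have bound := hj.sum_norm_sq_choiEffrosMul_le hQ h1 hid (ι := Fin n × s)
    (a := fun i p => a i p.1) (y := fun p => p.2)
    (d := fun l p => (if p.1 = l then (C : ℂ) else 0) • (p.2 : LinearMap.range Q)) (fun v => by
      have amplified := (norm_matOp_le_iff (a.map Subtype.val) (norm_nonneg (subMatOp _ a))).1
        le_rfl fun l => ∑ x : s, (x : LinearMap.range Q).1 (v (l, x))
      simpa only [Submodule.coe_smul, smul_apply, sum_single, norm_sq_smul, ← Finset.mul_sum,
        Fintype.sum_prod_type, ← map_sum, Matrix.map_apply] using amplified) fun p => f p.1 p.2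
  simpa only [hj.choiEffros_smul, sum_single, norm_sq_smul, ← Finset.mul_sum, Fintype.sum_prod_type,
    synthesis_eq_sum] using bound

variable [CompleteSpace K]

theorem exists_representation : ∃ σ : LinearMap.range Q →ₗ[ℂ] (K →L[ℂ] K),
    ∀ a f, σ a (synthesis j f) = synthesis (fun b => j (choiEffrosMul Q a b)) f := by
  let leftMul (a : LinearMap.range Q) := synthesis fun b => j (choiEffrosMul Q a b)
  have bound (a) : ∃ C : ℝ, ∀ f, ‖leftMul a f‖ ≤ C * ‖synthesis j f‖ := by
    refine ⟨‖subMatOp _ (Matrix.of fun _ _ : Fin 1 => a)‖, fun f => ?_⟩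
    have h := hj.sum_norm_sq_synthesis_choiEffrosMul_le hQ h1 hid (Matrix.of fun _ _ : Fin 1 => a)
      fun _ => f
    simp only [Finset.univ_unique, Finset.sum_singleton, ← mul_pow] at h
    exact le_of_sq_le_sq h (by positivity)
  have extend_apply (a f) : (leftMul a).extendOfNorm (synthesis j) (synthesis j f) = leftMul a f :=
    LinearMap.extendOfNorm_eq hj.denseRange (bound a) f
  have extend_single (a b ξ) : (leftMul a).extendOfNorm (synthesis j) (j b ξ) =
      j (choiEffrosMul Q a b) ξ := by
    rw [← synthesis_single j, extend_apply]
    exact synthesis_single _ _ _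
  exact ⟨{
    toFun a := (leftMul a).extendOfNorm (synthesis j)
    map_add' a a' := hj.ext_clm fun b ξ => by
      simp only [add_apply, extend_single, ← hj.choiEffros_add, choiEffrosMul, Submodule.coe_add,
        add_mul, map_add]
    map_smul' r a := hj.ext_clm fun b ξ => by
      simp only [smul_apply, extend_single, ← hj.choiEffros_smul, choiEffrosMul, Submodule.coe_smul,
        smul_mul_assoc, map_smul, RingHom.id_apply] }, extend_apply⟩

end IsKolmogorovDecomposition

section ChoiEffrosProduct

variable (hQ : IsRCP Q) (h1 : ‖Q 1‖ ≤ 1) (hid : ∀ b, Q (Q b) = Q b)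

include hQ h1 hid

theorem IsRCP.choiEffrosMul_assoc (x y z : LinearMap.range Q) :
    choiEffrosMul Q (choiEffrosMul Q x y) z = choiEffrosMul Q x (choiEffrosMul Q y z) :=
  Subtype.ext <| calc
    Q (Q (x * y) * z) = Q (x * y * z) := hQ.map_map_mul h1 hid (map_coe_range hid z) _
    _ = Q (x * Q (y * z)) := by
      rw [hQ.map_mul_map h1 hid (map_coe_range hid x), mul_assoc]

theorem IsRCP.one_choiEffrosMul (x : LinearMap.range Q) :
    choiEffrosMul Q (Q.rangeRestrict 1) x = x :=
  Subtype.ext <| calc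
    Q (Q 1 * x) = Q (1 * x) := hQ.map_map_mul h1 hid (map_coe_range hid x) _
    _ = x := by rw [one_mul, map_coe_range hid]

theorem IsRCP.choiEffrosMul_one (x : LinearMap.range Q) :
    choiEffrosMul Q x (Q.rangeRestrict 1) = x :=
  Subtype.ext <| calc
    Q (x * Q 1) = Q (x * 1) := hQ.map_mul_map h1 hid (map_coe_range hid x) _
    _ = x := by rw [mul_one, map_coe_range hid]

theorem IsRCP.choiEffrosKernel_one (x : LinearMap.range Q) :
    choiEffrosKernel Q (Q.rangeRestrict 1) x = x := by
  have star_one : star (Q 1) = Q 1 := by rw [← hQ.map_star, _root_.star_one]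
  calc Q (star (Q 1) * x) = choiEffrosMul Q (Q.rangeRestrict 1) x := by rw [star_one]; rfl
    _ = x := by rw [hQ.one_choiEffrosMul h1 hid]

end ChoiEffrosProduct

/-- A completely contractive map `τ` on a space of operators on `H`, with a contraction
`V : H → K` that recovers each `x` as the compression `V* τ(x) V`. -/
structure IsDilation {K : Type u} [NormedAddCommGroup K] [InnerProductSpace ℂ K] [CompleteSpace K]
    {F : Submodule ℂ (H →L[ℂ] H)} (τ : F →ₗ[ℂ] (K →L[ℂ] K)) (V : H →L[ℂ] K) : Prop where
  norm_matOp_le : ∀ (n : ℕ) (a : Matrix (Fin n) (Fin n) F), ‖matOp (a.map τ)‖ ≤ ‖subMatOp F a‖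
  norm_le_one : ‖V‖ ≤ 1
  inner_apply : ∀ x η ξ, ⟪V η, τ x (V ξ)⟫_ℂ = ⟪η, (x : H →L[ℂ] H) ξ⟫_ℂ

/-- A dilation that turns the product `m` with identity element `u` into the product of
operators. -/
structure IsMulDilation {K : Type u} [NormedAddCommGroup K] [InnerProductSpace ℂ K]
    [CompleteSpace K] {F : Submodule ℂ (H →L[ℂ] H)} (m : F → F → F) (u : F)
    (τ : F →ₗ[ℂ] (K →L[ℂ] K)) (V : H →L[ℂ] K) : Prop extends IsDilation τ V where
  map_mul : ∀ x y, τ (m x y) = τ x * τ y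
  map_unit : τ u = 1

theorem exists_isMulDilation_choiEffrosMul (hQ : IsRCP Q) (h1 : ‖Q 1‖ ≤ 1)
    (hid : ∀ b, Q (Q b) = Q b) :
    ∃ (K : Type u) (_ : NormedAddCommGroup K) (_ : InnerProductSpace ℂ K) (_ : CompleteSpace K)
      (σ : LinearMap.range Q →ₗ[ℂ] (K →L[ℂ] K)) (V : H →L[ℂ] K),
      IsMulDilation (choiEffrosMul Q) (Q.rangeRestrict 1) σ V := by
  obtain ⟨K, _, _, _, j, hj⟩ := exists_isKolmogorovDecomposition (choiEffrosKernel Q)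
    (fun x y => by simp [choiEffrosKernel, ← hQ.map_star])
    fun s => hQ.isAccretiveMatrix (isAccretiveMatrix_star_mul fun x : s => ((x : _) : H →L[ℂ] H))
  obtain ⟨σ, σ_synthesis⟩ := hj.exists_representation hQ h1 hid
  have σ_apply (a b ξ) : σ a (j b ξ) = j (choiEffrosMul Q a b) ξ := by
    simpa using σ_synthesis a (Finsupp.single b ξ)
  refine ⟨K, inferInstance, inferInstance, inferInstance, σ, j (Q.rangeRestrict 1),
    ⟨⟨fun n a => ?_, ?_, fun x η ξ => ?_⟩, fun x y => hj.ext_clm fun b ξ => ?_,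
    hj.ext_clm fun b ξ => ?_⟩⟩
  · refine (norm_matOp_le_iff _ (norm_nonneg _)).2 fun v => ?_
    refine (DenseRange.piMap fun _ : Fin n => hj.denseRange).induction_on v
      (isClosed_le (by fun_prop) (by fun_prop)) fun f => ?_
    simpa only [Pi.map_apply, Matrix.map_apply, σ_synthesis] using
      hj.sum_norm_sq_synthesis_choiEffrosMul_le hQ h1 hid a f
  · refine ContinuousLinearMap.opNorm_le_bound _ zero_le_one fun ξ => ?_
    have norm_sq_le : ‖j (Q.rangeRestrict 1) ξ‖ ^ 2 ≤ ‖ξ‖ ^ 2 := by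
      rw [← inner_self_eq_norm_sq (𝕜 := ℂ), hj.inner_apply, hQ.choiEffrosKernel_one h1 hid]
      simpa using re_inner_apply_self_le h1 ξ
    simpa using le_of_sq_le_sq norm_sq_le (norm_nonneg _)
  · rw [σ_apply, hj.inner_apply, hQ.choiEffrosMul_one h1 hid, hQ.choiEffrosKernel_one h1 hid]
  · simp only [mul_apply_eq_comp, σ_apply, hQ.choiEffrosMul_assoc h1 hid]
  · rw [σ_apply, hQ.one_choiEffrosMul h1 hid, one_apply_eq_self]

end Dilation

/-! ## The Krein–Šmulian theorem -/

section ZeroAtInfty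

open ZeroAtInfty

/-- The standard basis vector `δₘ` of `c₀`. -/
def deltaZero (m : ℕ) : C₀(ℕ, ℂ) :=
  ⟨⟨Pi.single m 1, continuous_of_discreteTopology⟩, by
    rw [cocompact_eq_cofinite]
    refine tendsto_const_nhds.congr' ?_
    filter_upwards [(Set.finite_singleton m).compl_mem_cofinite] with k hk
    exact (Pi.single_eq_of_ne (M := fun _ => ℂ) hk 1).symm⟩

theorem sum_smul_deltaZero_apply (s : Finset ℕ) (g : ℕ → ℂ) (k : ℕ) :
    (∑ m ∈ s, g m • deltaZero m) k = if k ∈ s then g k else 0 := by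
  induction s using Finset.induction_on with
  | empty => rfl
  | insert m s hm ih =>
    rw [Finset.sum_insert hm, ZeroAtInftyContinuousMap.add_apply, ih]
    change g m * (Pi.single m 1 : ℕ → ℂ) k + _ = _
    rcases eq_or_ne k m with rfl | hk
    · simp [hm]
    · simp [hk]

theorem norm_zeroAtInfty_le {f : C₀(ℕ, ℂ)} {C : ℝ} (hC : 0 ≤ C) : ‖f‖ ≤ C ↔ ∀ m, ‖f m‖ ≤ C := by
  rw [← ZeroAtInftyContinuousMap.norm_toBCF_eq_norm]
  exact BoundedContinuousFunction.norm_le hC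

theorem hasSum_smul_deltaZero (f : C₀(ℕ, ℂ)) : HasSum (fun m => f m • deltaZero m) f := by
  refine Metric.tendsto_atTop.2 fun ε hε => ?_
  have finite_large : {m | ¬‖f m‖ < ε / 2}.Finite := by
    have vanish := zero_at_infty f
    rw [cocompact_eq_cofinite] at vanish
    exact eventually_cofinite.1 (by simpa using vanish.norm.eventually_lt_const (by simpa using hε))
  refine ⟨finite_large.toFinset, fun s hs => ?_⟩
  rw [dist_eq_norm]
  refine ((norm_zeroAtInfty_le (half_pos hε).le).2 fun m => ?_).trans_lt (half_lt_self hε)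
  rw [ZeroAtInftyContinuousMap.sub_apply, sum_smul_deltaZero_apply]
  split_ifs with hm
  · simpa using (half_pos hε).le
  · have small : ‖f m‖ < ε / 2 := by
      by_contra large
      exact hm (hs (finite_large.mem_toFinset.2 large))
    simpa using small.le

theorem summable_norm_apply_deltaZero (φ : StrongDual ℂ C₀(ℕ, ℂ)) :
    Summable fun m => ‖φ (deltaZero m)‖ := by
  refine summable_of_sum_le (c := ‖φ‖) (fun m => norm_nonneg _) fun s => ?_
  choose c norm_c hc using fun m => RCLike.exists_norm_eq_mul_self (φ (deltaZero m))
  have norm_le_one : ‖∑ m ∈ s, c m • deltaZero m‖ ≤ 1 :=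
    (norm_zeroAtInfty_le zero_le_one).2 fun m => by
      rw [sum_smul_deltaZero_apply]
      split_ifs <;> simp [norm_c]
  have apply_sum : φ (∑ m ∈ s, c m • deltaZero m) = (∑ m ∈ s, ‖φ (deltaZero m)‖ : ℝ) := by
    simp only [map_sum, map_smul, smul_eq_mul, Complex.ofReal_sum]
    exact Finset.sum_congr rfl fun m _ => (hc m).symm
  calc ∑ m ∈ s, ‖φ (deltaZero m)‖ = ‖φ (∑ m ∈ s, c m • deltaZero m)‖ := by
        rw [apply_sum, Complex.norm_real, Real.norm_of_nonneg (by positivity)]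
    _ ≤ ‖φ‖ := φ.unit_le_opNorm _ norm_le_one

theorem hasSum_dual_zeroAtInfty (φ : StrongDual ℂ C₀(ℕ, ℂ)) (f : C₀(ℕ, ℂ)) :
    HasSum (fun m => φ (deltaZero m) * f m) (φ f) := by
  simpa [mul_comm] using (hasSum_smul_deltaZero f).mapL φ

end ZeroAtInfty

theorem exists_dual_eq_zero_of_isClosed {E : Type*} [NormedAddCommGroup E] [NormedSpace ℂ E]
    {p : Submodule ℂ E} (hp : IsClosed (p : Set E)) {x : E} (hx : x ∉ p) :
    ∃ φ : StrongDual ℂ E, (∀ y ∈ p, φ y = 0) ∧ φ x ≠ 0 := by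
  have ne_zero : p.mkQL x ≠ 0 := fun h => hx ((Submodule.Quotient.mk_eq_zero p).1 h)
  obtain ⟨g, hg⟩ := SeparatingDual.exists_ne_zero (R := ℂ) ne_zero
  refine ⟨g.comp p.mkQL, fun y hy => ?_, hg⟩
  have : p.mkQL y = 0 := (Submodule.Quotient.mk_eq_zero p).2 hy
  simp [this]

theorem exists_seq_enumerating_finsets {α : Type*} (g : ℕ → Finset α)
    (hg : ∀ n, (g n).Nonempty) :
    ∃ (u : ℕ → α) (k : ℕ → ℕ), Tendsto k atTop atTop ∧ (∀ m, u m ∈ g (k m)) ∧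
      ∀ n, ∀ q ∈ g n, ∃ m, u m = q := by
  have : Infinite (Σ n, g n) := Infinite.of_surjective Sigma.fst fun n =>
    ⟨⟨n, _, (hg n).choose_spec⟩, rfl⟩
  obtain ⟨e⟩ := nonempty_equiv_of_countable (α := ℕ) (β := Σ n, g n)
  have tendsto_fst : Tendsto (Sigma.fst : (Σ n, g n) → ℕ) cofinite cofinite :=
    Tendsto.cofinite_of_finite_preimage_singleton fun n => by
      refine (Set.finite_range (Sigma.mk n)).subset ?_
      rintro ⟨_, q⟩ rfl
      exact ⟨q, rfl⟩
  refine ⟨fun m => (e m).2, fun m => (e m).1, ?_, fun m => (e m).2.2, fun n q hq =>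
    ⟨e.symm ⟨n, q, hq⟩, by beta_reduce; rw [Equiv.apply_symm_apply]⟩⟩
  rw [← Nat.cofinite_eq_atTop]
  exact tendsto_fst.comp e.injective.tendsto_cofinite

section KreinSmulian

variable {H : Type u} [NormedAddCommGroup H] [InnerProductSpace ℂ H]

theorem memℓp_two_smul {a b : ℕ → ℂ} (ha : Summable fun m => ‖a m‖)
    (hb : ∀ m, ‖b m‖ ^ 2 = ‖a m‖) {ζ : ℕ → H} {C : ℝ} (hζ : ∀ m, ‖ζ m‖ ≤ C) :
    Memℓp (fun m => b m • ζ m) 2 := by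
  refine memℓp_gen (.of_nonneg_of_le (fun m => by positivity) (fun m => ?_) (ha.mul_right (C ^ 2)))
  rw [ENNReal.toReal_ofNat, Real.rpow_ofNat, norm_smul, mul_pow, hb]
  gcongr
  exact hζ m

theorem exists_lp_inner_eq {a : ℕ → ℂ} (ha : Summable fun m => ‖a m‖) {η ξ : ℕ → H} {C : ℝ}
    (hη : ∀ m, ‖η m‖ ≤ C) (hξ : ∀ m, ‖ξ m‖ ≤ C) :
    ∃ p : lp (fun _ : ℕ => H) 2 × lp (fun _ : ℕ => H) 2, ∀ (x : H →L[ℂ] H) (m : ℕ),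
      ⟪p.2 m, x (p.1 m)⟫_ℂ = a m * ⟪η m, x (ξ m)⟫_ℂ := by
  choose c norm_c hc using fun m => RCLike.exists_norm_eq_mul_self (a m)
  have sqrt_sq (m) : ((√‖a m‖ : ℝ) : ℂ) * (√‖a m‖ : ℝ) = c m * a m := by
    rw [← Complex.ofReal_mul, Real.mul_self_sqrt (norm_nonneg _)]
    exact hc m
  have conj_mul_c (m) : conj (c m) * c m = 1 := by
    rw [RCLike.conj_mul, norm_c]
    simp
  refine ⟨(⟨_, memℓp_two_smul (b := fun m => (√‖a m‖ : ℝ)) ha (fun m => ?_) hξ⟩,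
    ⟨_, memℓp_two_smul (b := fun m => c m * (√‖a m‖ : ℝ)) ha (fun m => ?_) hη⟩), fun x m => ?_⟩
  · rw [Complex.norm_real, Real.norm_eq_abs, sq_abs, Real.sq_sqrt (norm_nonneg _)]
  · rw [norm_mul, norm_c, one_mul, Complex.norm_real, Real.norm_eq_abs, sq_abs,
      Real.sq_sqrt (norm_nonneg _)]
  · calc ⟪(c m * (√‖a m‖ : ℝ)) • η m, x (((√‖a m‖ : ℝ) : ℂ) • ξ m)⟫_ℂ
        = conj (c m) * (((√‖a m‖ : ℝ) : ℂ) * (√‖a m‖ : ℝ)) * ⟪η m, x (ξ m)⟫_ℂ := by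
          rw [map_smul, inner_smul_left, inner_smul_right, map_mul, Complex.conj_ofReal]
          ring
      _ = a m * ⟪η m, x (ξ m)⟫_ℂ := by rw [sqrt_sq, ← mul_assoc, conj_mul_c, one_mul]

open ZeroAtInfty in
/-- The map `x ↦ (⟪ηₘ, x ξₘ⟫)ₘ` into `c₀`, for a bounded sequence `η` and a null sequence `ξ`. -/
def innerSeq {η ξ : ℕ → H} (hη : ∀ m, ‖η m‖ ≤ 1) (hξ : Tendsto (fun m => ‖ξ m‖) atTop (𝓝 0)) :
    (H →L[ℂ] H) →ₗ[ℂ] C₀(ℕ, ℂ) where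
  toFun x := ⟨⟨fun m => ⟪η m, x (ξ m)⟫_ℂ, continuous_of_discreteTopology⟩, by
    rw [cocompact_eq_cofinite, Nat.cofinite_eq_atTop]
    refine squeeze_zero_norm (fun m => ?_) (by simpa using hξ.const_mul ‖x‖)
    refine (norm_inner_apply_le x le_rfl _ _).trans ?_
    gcongr
    exact mul_le_of_le_one_left (norm_nonneg _) (hη m)⟩
  map_add' x y := by
    ext m
    exact inner_add_right _ _ _
  map_smul' c x := by
    ext m
    exact inner_smul_right _ _ _

theorem exists_weakStar_separating_of_seq {S : Submodule ℂ (H →L[ℂ] H)} {x₀ : H →L[ℂ] H}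
    {η ξ : ℕ → H} (hη : ∀ m, ‖η m‖ ≤ 1) (hξ : Tendsto (fun m => ‖ξ m‖) atTop (𝓝 0))
    (h : ∀ x ∈ S, ∃ m, 1 < ‖⟪η m, (x - x₀) (ξ m)⟫_ℂ‖) :
    ∃ p : lp (fun _ : ℕ => H) 2 × lp (fun _ : ℕ => H) 2,
      (∀ x ∈ S, ∑' n, ⟪p.2 n, x (p.1 n)⟫_ℂ = 0) ∧ ∑' n, ⟪p.2 n, x₀ (p.1 n)⟫_ℂ ≠ 0 := by
  let T := innerSeq hη hξ
  have notMem_closure : T x₀ ∉ (S.map T).topologicalClosure := fun hmem => by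
    obtain ⟨_, ⟨x, hx, rfl⟩, dist_lt⟩ := Metric.mem_closure_iff.1 hmem 1 one_pos
    obtain ⟨m, hm⟩ := h x hx
    rw [dist_comm, dist_eq_norm, ← map_sub] at dist_lt
    exact hm.not_ge ((norm_zeroAtInfty_le zero_le_one).1 dist_lt.le m)
  obtain ⟨φ, φ_S, φ_x₀⟩ :=
    exists_dual_eq_zero_of_isClosed (Submodule.isClosed_topologicalClosure _) notMem_closure
  obtain ⟨C, hC⟩ := hξ.bddAbove_range
  obtain ⟨p, hp⟩ := exists_lp_inner_eq (summable_norm_apply_deltaZero φ)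
    (fun m => (hη m).trans (le_max_left 1 C))
    (fun m => (hC (Set.mem_range_self m)).trans (le_max_right 1 C))
  have tsum_eq (x) : ∑' n, ⟪p.2 n, x (p.1 n)⟫_ℂ = φ (T x) := by
    simp only [hp]
    exact (hasSum_dual_zeroAtInfty φ (T x)).tsum_eq
  refine ⟨p, fun x hx => ?_, (tsum_eq x₀).trans_ne φ_x₀⟩
  rw [tsum_eq]
  exact φ_S _ (Submodule.le_topologicalClosure _ (Submodule.mem_map_of_mem hx))

/-- `S` contains the weak limits of its bounded families. -/
def IsBddWClosed (S : Submodule ℂ (H →L[ℂ] H)) : Prop :=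
  ∀ (𝒰 : Ultrafilter S) (T₀ : H →L[ℂ] H) (r : ℝ), (∀ᶠ x in (𝒰 : Filter S), ‖x‖ ≤ r) →
    WTendsto (fun x : S => (x : H →L[ℂ] H)) 𝒰 T₀ → T₀ ∈ S

theorem wTendsto_map {α β : Type*} {m : α → β} {l : Filter α} {T : β → H →L[ℂ] H}
    {T₀ : H →L[ℂ] H} : WTendsto T (map m l) T₀ ↔ WTendsto (fun a => T (m a)) l T₀ :=
  forall₂_congr fun _ _ => tendsto_map'_iff

theorem IsBddWClosed.mem_of_wTendsto {S : Submodule ℂ (H →L[ℂ] H)} (hS : IsBddWClosed S)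
    {α : Type*} {𝒰 : Ultrafilter α} {x : α → H →L[ℂ] H} {T₀ : H →L[ℂ] H} {r : ℝ}
    (hxS : ∀ a, x a ∈ S) (hx : ∀ᶠ a in (𝒰 : Filter α), ‖x a‖ ≤ r) (h : WTendsto x 𝒰 T₀) :
    T₀ ∈ S :=
  hS (𝒰.map fun a => ⟨x a, hxS a⟩) T₀ r hx (wTendsto_map.2 h)

theorem IsBddWClosed.isClosed {S : Submodule ℂ (H →L[ℂ] H)} (hS : IsBddWClosed S) :
    IsClosed (S : Set (H →L[ℂ] H)) := by
  refine isClosed_of_closure_subset fun T₀ hT₀ => ?_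
  obtain ⟨x, hxS, hx⟩ := mem_closure_iff_seq_limit.1 hT₀
  have bounded : ∀ᶠ n in (hyperfilter ℕ : Filter ℕ), ‖x n‖ ≤ ‖T₀‖ + 1 :=
    Nat.hyperfilter_le_atTop (hx.norm.eventually_le_const (lt_add_one _))
  exact hS.mem_of_wTendsto hxS bounded
    (wTendsto_of_tendsto (hx.mono_left Nat.hyperfilter_le_atTop))

/-- No element of `S` within `r` of `x₀` lies in the weak neighbourhood of `x₀` given by the set `G`
of pairs of vectors. -/
def SeparatesWithin (S : Submodule ℂ (H →L[ℂ] H)) (x₀ : H →L[ℂ] H) (G : Set (H × H))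
    (r : ℝ) : Prop :=
  ∀ x ∈ S, ‖x - x₀‖ ≤ r → ∃ q ∈ G, 1 < ‖⟪q.1, (x - x₀) q.2⟫_ℂ‖

variable [CompleteSpace H] {S : Submodule ℂ (H →L[ℂ] H)} {x₀ : H →L[ℂ] H}

theorem SeparatesWithin.exists_union {r : ℝ} {G : Set (H × H)} (hG : SeparatesWithin S x₀ G r)
    (hS : IsBddWClosed S) (hr : 0 < r) (r' : ℝ) :
    ∃ G' : Finset (H × H), (∀ q ∈ G', ‖q.1‖ ≤ 1 ∧ ‖q.2‖ ≤ r⁻¹) ∧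
      SeparatesWithin S x₀ (G ∪ G') r' := by
  by_contra! not_separates
  let W := {q : H × H // ‖q.1‖ ≤ 1 ∧ ‖q.2‖ ≤ r⁻¹}
  have exists_near (g : Finset W) : ∃ x ∈ S, ‖x - x₀‖ ≤ r' ∧
      (∀ q ∈ G, ‖⟪q.1, (x - x₀) q.2⟫_ℂ‖ ≤ 1) ∧ ∀ q ∈ g, ‖⟪q.1.1, (x - x₀) q.1.2⟫_ℂ‖ ≤ 1 := by
    have h := not_separates (g.map (Function.Embedding.subtype _)) fun q hq => by
      obtain ⟨w, -, rfl⟩ := Finset.mem_map.1 hq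
      exact w.2
    simp only [SeparatesWithin, not_forall, not_exists, not_and, not_lt] at h
    obtain ⟨x, hxS, hxr, hx⟩ := h
    exact ⟨x, hxS, hxr, fun q hq => hx q (Or.inl hq), fun q hq =>
      hx q (Or.inr (Finset.mem_map_of_mem _ hq))⟩
  choose x hxS hxr hxG hxg using exists_near
  let 𝒰 : Ultrafilter (Finset W) := Ultrafilter.of atTop
  have bounded : ∀ᶠ g in (𝒰 : Filter (Finset W)), ‖x g‖ ≤ ‖x₀‖ + r' :=
    .of_forall fun g => by
      have h : ‖x g‖ ≤ ‖x₀‖ + ‖x g - x₀‖ := norm_le_norm_add_norm_sub' _ _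
      linarith [hxr g]
  obtain ⟨T₀, -, tendsto_T₀⟩ := exists_wTendsto 𝒰 x bounded
  have T₀_mem : T₀ ∈ S := hS.mem_of_wTendsto hxS bounded tendsto_T₀
  have tendsto_sub := tendsto_T₀.sub (wTendsto_const x₀ _)
  have inner_le_one (η ξ : H) (hη : ‖η‖ ≤ 1) (hξ : ‖ξ‖ ≤ r⁻¹) : ‖⟪η, (T₀ - x₀) ξ⟫_ℂ‖ ≤ 1 := by
    refine le_of_tendsto (tendsto_sub η ξ).norm (Ultrafilter.of_le atTop ?_)
    filter_upwards [eventually_ge_atTop {⟨(η, ξ), hη, hξ⟩}] with g hg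
    exact hxg g ⟨(η, ξ), hη, hξ⟩ (hg (Finset.mem_singleton_self _))
  have norm_le : ‖T₀ - x₀‖ ≤ r := by
    refine ContinuousLinearMap.opNorm_le_of_re_inner_le hr.le fun ξ η hξ hη => ?_
    have norm_scaled : ‖((r⁻¹ : ℝ) : ℂ) • ξ‖ ≤ r⁻¹ := by
      rw [norm_smul, hξ, mul_one, Complex.norm_real, Real.norm_of_nonneg (by positivity)]
    have h := inner_le_one η _ hη.le norm_scaled
    rw [map_smul, inner_smul_right, norm_mul, Complex.norm_real,
      Real.norm_of_nonneg (by positivity), inv_mul_le_iff₀ hr, mul_one, norm_inner_symm] at h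
    exact (RCLike.re_le_norm _).trans h
  obtain ⟨q, hq, one_lt⟩ := hG T₀ T₀_mem norm_le
  exact one_lt.not_ge (le_of_tendsto (tendsto_sub q.1 q.2).norm (.of_forall fun g => hxG g q hq))

theorem IsBddWClosed.exists_seq_separatesWithin (hS : IsBddWClosed S) (hx₀ : x₀ ∉ S) :
    ∃ δ : ℝ, 0 < δ ∧ ∃ g : ℕ → Finset (H × H),
      (∀ n, ∀ q ∈ g n, ‖q.1‖ ≤ 1 ∧ ‖q.2‖ ≤ (δ * (n + 1))⁻¹) ∧
      ∀ n : ℕ, SeparatesWithin S x₀ (⋃ k < n, g k) (δ * (n + 1)) := by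
  obtain ⟨δ, hδ, closedBall_subset⟩ := Metric.nhds_basis_closedBall.mem_iff.1
    (hS.isClosed.isOpen_compl.mem_nhds hx₀)
  have step (n : ℕ) (G : Set (H × H)) (hG : SeparatesWithin S x₀ G (δ * (n + 1))) :=
    hG.exists_union hS (by positivity) (δ * ((n + 1 : ℕ) + 1))
  choose! f f_le separates_union using step
  let G (n : ℕ) : Set (H × H) := Nat.rec ∅ (fun n G => G ∪ f n G) n
  have separates (n : ℕ) : SeparatesWithin S x₀ (G n) (δ * (n + 1)) := by
    induction n with
    | zero =>
      refine fun x hx hxr => absurd hx (closedBall_subset ?_)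
      simpa [dist_eq_norm] using hxr
    | succ n ih => exact separates_union n _ ih
  have G_eq (n : ℕ) : G n = ⋃ k < n, (f k (G k) : Set (H × H)) := by
    induction n with
    | zero => simp [G]
    | succ n ih =>
      rw [Set.biUnion_lt_succ, ← ih]
  exact ⟨δ, hδ, fun n => f n (G n), fun n => f_le n _ (separates n), fun n => G_eq n ▸ separates n⟩

theorem IsBddWClosed.exists_weakStar_separating (hS : IsBddWClosed S) (hx₀ : x₀ ∉ S) :
    ∃ p : lp (fun _ : ℕ => H) 2 × lp (fun _ : ℕ => H) 2,
      (∀ x ∈ S, ∑' n, ⟪p.2 n, x (p.1 n)⟫_ℂ = 0) ∧ ∑' n, ⟪p.2 n, x₀ (p.1 n)⟫_ℂ ≠ 0 := by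
  classical
  obtain ⟨δ, hδ, g, hg, separates⟩ := hS.exists_seq_separatesWithin hx₀
  obtain ⟨q, k, tendsto_k, q_mem, q_surj⟩ := exists_seq_enumerating_finsets
    (fun n => insert (0, 0) (g n)) fun n => Finset.insert_nonempty _ _
  have q_le (m : ℕ) : ‖(q m).1‖ ≤ 1 ∧ ‖(q m).2‖ ≤ (δ * (k m + 1))⁻¹ := by
    rcases Finset.mem_insert.1 (q_mem m) with hq | hq
    · simp only [hq, norm_zero, zero_le_one, true_and]
      positivity
    · exact hg _ _ hq
  have tendsto_radius : Tendsto (fun m => (δ * ((k m : ℝ) + 1))⁻¹) atTop (𝓝 0) :=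
    tendsto_inv_atTop_zero.comp
      (.const_mul_atTop hδ
        (tendsto_atTop_add_const_right _ 1 (tendsto_natCast_atTop_atTop.comp tendsto_k)))
  refine exists_weakStar_separating_of_seq (fun m => (q_le m).1)
    (squeeze_zero (fun _ => norm_nonneg _) (fun m => (q_le m).2) tendsto_radius) fun x hx => ?_
  obtain ⟨N, hN⟩ := exists_nat_ge (‖x - x₀‖ / δ)
  have norm_le : ‖x - x₀‖ ≤ δ * (N + 1) := by
    rw [div_le_iff₀ hδ] at hN
    linarith
  obtain ⟨w, hw, one_lt⟩ := separates N x hx norm_le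
  obtain ⟨n, -, hwn⟩ := Set.mem_iUnion₂.1 hw
  obtain ⟨m, rfl⟩ := q_surj n w (Finset.mem_insert_of_mem hwn)
  exact ⟨m, one_lt⟩

theorem IsBddWClosed.isWeakStarClosed (hS : IsBddWClosed S) : IsWeakStarClosed S := by
  let _ := weakStar H
  refine isClosed_iff_ultrafilter.2 fun x₀ 𝒰 h𝒰 mem_S => ?_
  by_contra hx₀
  obtain ⟨p, hp, hp₀⟩ := hS.exists_weakStar_separating hx₀
  refine hp₀ (tendsto_nhds_unique ((tendsto_weakStar_iff (T := id)).1 h𝒰 p) ?_)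
  exact tendsto_const_nhds.congr' (mem_of_superset mem_S fun x hx => (hp x hx).symm)

theorem IsWeakStarClosed.isBddWClosed (hS : IsWeakStarClosed S) : IsBddWClosed S :=
  fun _ _ _ bounded h => by
    let _ := weakStar H
    exact IsClosed.mem_of_tendsto hS (h.tendsto_weakStar bounded) (.of_forall fun x => x.2)

end KreinSmulian

section DualRepresentations

variable {H : Type u} [NormedAddCommGroup H] [InnerProductSpace ℂ H]
  {K : Type u} [NormedAddCommGroup K] [InnerProductSpace ℂ K]

/-- A map between spaces of operators that preserves weak limits of bounded families; for linear
isometries between weak* closed spaces this amounts to weak* continuity. -/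
def BddWContinuous {F : Submodule ℂ (H →L[ℂ] H)} (f : F → K →L[ℂ] K) : Prop :=
  ∀ (𝒰 : Ultrafilter F) (x₀ : F) (r : ℝ), (∀ᶠ x in (𝒰 : Filter F), ‖x‖ ≤ r) →
    WTendsto (fun x : F => (x : H →L[ℂ] H)) 𝒰 x₀ → WTendsto f 𝒰 (f x₀)

theorem BddWContinuous.wTendsto {F : Submodule ℂ (H →L[ℂ] H)} {f : F → K →L[ℂ] K}
    (hf : BddWContinuous f) {α : Type*} {𝒰 : Ultrafilter α} {x : α → F} {x₀ : F} {r : ℝ}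
    (hx : ∀ᶠ a in (𝒰 : Filter α), ‖x a‖ ≤ r) (h : WTendsto (fun a => (x a : H →L[ℂ] H)) 𝒰 x₀) :
    WTendsto (fun a => f (x a)) 𝒰 (f x₀) :=
  wTendsto_map.1 (hf (𝒰.map x) x₀ r hx (wTendsto_map.2 h))

theorem IsBddWClosed.map_ker {F : Submodule ℂ (H →L[ℂ] H)} (hF : IsBddWClosed F) (f : F →ₗ[ℂ] ℂ)
    (hf : ∀ (𝒰 : Ultrafilter F) (x₀ : F) (r : ℝ), (∀ᶠ x in (𝒰 : Filter F), ‖x‖ ≤ r) →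
      WTendsto (fun x : F => (x : H →L[ℂ] H)) 𝒰 x₀ → Tendsto f 𝒰 (𝓝 (f x₀))) :
    IsBddWClosed (f.ker.map F.subtype) := by
  intro 𝒰 T₀ r bounded tendsto_T₀
  have mem_F (x : f.ker.map F.subtype) : (x : H →L[ℂ] H) ∈ F := Submodule.map_subtype_le _ _ x.2
  have map_eq_zero (x : f.ker.map F.subtype) : f ⟨x, mem_F x⟩ = 0 := by
    obtain ⟨_, y, hy, rfl⟩ := x
    exact hy
  have T₀_mem : T₀ ∈ F := hF.mem_of_wTendsto mem_F bounded tendsto_T₀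
  have tendsto_f := hf (𝒰.map fun x : f.ker.map F.subtype => ⟨x, mem_F x⟩) ⟨T₀, T₀_mem⟩ r bounded
    (wTendsto_map.2 tendsto_T₀)
  refine ⟨⟨T₀, T₀_mem⟩, tendsto_nhds_unique (tendsto_map'_iff.1 tendsto_f) ?_, rfl⟩
  exact tendsto_const_nhds.congr fun x : f.ker.map F.subtype => (map_eq_zero x).symm

theorem exists_wTendsto_symm [CompleteSpace H] {F : Submodule ℂ (H →L[ℂ] H)}
    {N : Submodule ℂ (K →L[ℂ] K)} {π : F ≃ₗ[ℂ] N} (hF : IsBddWClosed F)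
    (norm_map : ∀ x, ‖π x‖ = ‖x‖) (hπ : BddWContinuous fun x => (π x : K →L[ℂ] K))
    {𝒱 : Ultrafilter N} {T₀ : K →L[ℂ] K} {r : ℝ}
    (bounded : ∀ᶠ y in (𝒱 : Filter N), ‖y‖ ≤ r)
    (hT₀ : WTendsto (fun y : N => (y : K →L[ℂ] K)) 𝒱 T₀) :
    ∃ x₀ : F, (π x₀ : K →L[ℂ] K) = T₀ ∧
      WTendsto (fun y : N => (π.symm y : H →L[ℂ] H)) 𝒱 x₀ := by
  have bounded_symm : ∀ᶠ y in (𝒱 : Filter N), ‖π.symm y‖ ≤ r :=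
    bounded.mono fun y hy => by rwa [← norm_map, π.apply_symm_apply]
  obtain ⟨x₀, -, hx₀⟩ := exists_wTendsto 𝒱 (fun y : N => (π.symm y : H →L[ℂ] H)) bounded_symm
  have x₀_mem : x₀ ∈ F := hF.mem_of_wTendsto (fun y => (π.symm y).2) bounded_symm hx₀
  have tendsto_map := hπ.wTendsto (x₀ := ⟨x₀, x₀_mem⟩) bounded_symm hx₀
  simp only [π.apply_symm_apply] at tendsto_map
  exact ⟨⟨x₀, x₀_mem⟩, tendsto_map.unique hT₀, hx₀⟩

variable [CompleteSpace H] [CompleteSpace K]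

/-- The embedding of `B(H)` into a product of copies of `ℂ` that induces the weak* topology. -/
def weakStarEval (H : Type u) [NormedAddCommGroup H] [InnerProductSpace ℂ H] :
    (H →L[ℂ] H) →ₗ[ℂ] (lp (fun _ : ℕ => H) 2 × lp (fun _ : ℕ => H) 2 → ℂ) where
  toFun x p := ∑' n, ⟪p.2 n, x (p.1 n)⟫_ℂ
  map_add' x y := by
    ext p
    simp only [add_apply, inner_add_right, Pi.add_apply]
    exact (summable_inner_apply x p).tsum_add (summable_inner_apply y p)
  map_smul' c x := by
    ext p
    simp only [smul_apply, inner_smul_right, Pi.smul_apply, RingHom.id_apply, smul_eq_mul]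
    exact tsum_mul_left

theorem relWeakStar_eq_induced (F : Submodule ℂ (H →L[ℂ] H)) :
    relWeakStar F = .induced (weakStarEval H ∘ₗ F.subtype) Pi.topologicalSpace :=
  induced_compose

theorem IsWeakStarClosed.continuous_of_bounded {F : Submodule ℂ (H →L[ℂ] H)}
    (hF : IsWeakStarClosed F) (f : F →ₗ[ℂ] ℂ)
    (hf : ∀ (𝒰 : Ultrafilter F) (x₀ : F) (r : ℝ), (∀ᶠ x in (𝒰 : Filter F), ‖x‖ ≤ r) →
      WTendsto (fun x : F => (x : H →L[ℂ] H)) 𝒰 x₀ → Tendsto f 𝒰 (𝓝 (f x₀))) :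
    Continuous[relWeakStar F, inferInstance] f := by
  have isWeakStarClosed_ker := (hF.isBddWClosed.map_ker f hf).isWeakStarClosed
  have : @IsTopologicalAddGroup F (relWeakStar F) _ := by
    rw [relWeakStar_eq_induced]
    exact topologicalAddGroup_induced _
  have : @ContinuousSMul ℂ F _ _ (relWeakStar F) := by
    rw [relWeakStar_eq_induced]
    exact continuousSMul_induced _
  let _ : TopologicalSpace F := relWeakStar F
  let _ : TopologicalSpace (H →L[ℂ] H) := weakStar H
  change Continuous f
  rw [LinearMap.continuous_iff_isClosed_ker,
    ← Set.preimage_image_eq (f.ker : Set F) Subtype.val_injective]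
  exact IsClosed.preimage continuous_induced_dom isWeakStarClosed_ker

theorem IsWeakStarClosed.isWeakStarContinuous {F : Submodule ℂ (H →L[ℂ] H)}
    (hF : IsWeakStarClosed F) {N : Submodule ℂ (K →L[ℂ] K)} (T : F →ₗ[ℂ] N)
    (norm_le : ∀ x, ‖T x‖ ≤ ‖x‖) (hT : BddWContinuous fun x => (T x : K →L[ℂ] K)) :
    IsWeakStarContinuous T := by
  rw [IsWeakStarContinuous, relWeakStar_eq_induced N, continuous_induced_rng]
  let _ : TopologicalSpace F := relWeakStar F
  refine continuous_pi fun p => hF.continuous_of_bounded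
    ((LinearMap.proj p) ∘ₗ (weakStarEval K ∘ₗ N.subtype) ∘ₗ T) fun 𝒰 x₀ r bounded h => ?_
  exact tendsto_weakStar_iff.1 ((hT 𝒰 x₀ r bounded h).tendsto_weakStar
    (bounded.mono fun x hx => (norm_le x).trans hx)) p

section LinearEquiv

variable {F : Submodule ℂ (H →L[ℂ] H)} {N : Submodule ℂ (K →L[ℂ] K)} {π : F ≃ₗ[ℂ] N}

theorem IsWeakStarClosed.of_linearEquiv (hF : IsWeakStarClosed F) (norm_map : ∀ x, ‖π x‖ = ‖x‖)
    (hπ : BddWContinuous fun x => (π x : K →L[ℂ] K)) : IsWeakStarClosed N := by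
  refine IsBddWClosed.isWeakStarClosed fun 𝒱 T₀ r bounded hT₀ => ?_
  obtain ⟨x₀, rfl, -⟩ := exists_wTendsto_symm hF.isBddWClosed norm_map hπ bounded hT₀
  exact (π x₀).2

theorem IsWeakStarClosed.isWeakStarContinuous_symm (hF : IsWeakStarClosed F)
    (norm_map : ∀ x, ‖π x‖ = ‖x‖) (hπ : BddWContinuous fun x => (π x : K →L[ℂ] K)) :
    IsWeakStarContinuous π.symm.toLinearMap := by
  refine (hF.of_linearEquiv norm_map hπ).isWeakStarContinuous _ (fun y => ?_)
    fun 𝒱 y₀ r bounded hy₀ => ?_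
  · exact (by rw [← norm_map, π.apply_symm_apply] : ‖π.symm y‖ = ‖y‖).le
  · obtain ⟨x₀, hx₀, h⟩ := exists_wTendsto_symm hF.isBddWClosed norm_map hπ bounded hy₀
    obtain rfl : x₀ = π.symm y₀ := π.eq_symm_apply.2 (Subtype.ext hx₀)
    exact h

end LinearEquiv

end DualRepresentations

/-! ## Weak* continuous dilations -/

section Compression

variable {H K L : Type u} [NormedAddCommGroup H] [InnerProductSpace ℂ H]
  [NormedAddCommGroup K] [InnerProductSpace ℂ K] [NormedAddCommGroup L] [InnerProductSpace ℂ L]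

theorem norm_matOp_comp_le [CompleteSpace K] [CompleteSpace L] {n : ℕ}
    (a : Matrix (Fin n) (Fin n) (K →L[ℂ] K)) {A : K →L[ℂ] L} {B : L →L[ℂ] K} (hA : ‖A‖ ≤ 1)
    (hB : ‖B‖ ≤ 1) : ‖matOp (a.map fun T => A ∘L T ∘L B)‖ ≤ ‖matOp a‖ := by
  refine (norm_matOp_le_iff _ (norm_nonneg _)).2 fun v => ?_
  have norm_A_le (k : K) : ‖A k‖ ≤ ‖k‖ := by simpa using A.le_of_opNorm_le hA k
  have norm_B_le (l : L) : ‖B l‖ ≤ ‖l‖ := by simpa using B.le_of_opNorm_le hB l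
  calc ∑ i, ‖∑ j, A (a i j (B (v j)))‖ ^ 2 ≤ ∑ i, ‖∑ j, a i j (B (v j))‖ ^ 2 := by
        gcongr with i
        rw [← map_sum]
        exact norm_A_le _
    _ ≤ ‖matOp a‖ ^ 2 * ∑ j, ‖B (v j)‖ ^ 2 :=
        (norm_matOp_le_iff a (norm_nonneg _)).1 le_rfl fun j => B (v j)
    _ ≤ ‖matOp a‖ ^ 2 * ∑ j, ‖v j‖ ^ 2 := by
        gcongr with j
        exact norm_B_le _

theorem norm_matOp_of_const [CompleteSpace H] (T : H →L[ℂ] H) :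
    ‖matOp (Matrix.of fun _ _ : Fin 1 => T)‖ = ‖T‖ := by
  refine eq_of_forall_ge_iff fun C => ?_
  rcases lt_or_ge C 0 with hC | hC
  · exact iff_of_false (hC.trans_le (norm_nonneg _)).not_ge (hC.trans_le (norm_nonneg _)).not_ge
  · rw [norm_matOp_le_iff _ hC, ContinuousLinearMap.opNorm_le_iff hC]
    simp only [Finset.univ_unique, Finset.sum_singleton, Matrix.of_apply, ← mul_pow]
    exact ⟨fun h ξ => le_of_sq_le_sq (h fun _ => ξ) (by positivity),
      fun h v => pow_le_pow_left₀ (norm_nonneg _) (h _) 2⟩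

namespace IsDilation

variable [CompleteSpace H] [CompleteSpace K] {F : Submodule ℂ (H →L[ℂ] H)}
  {τ : F →ₗ[ℂ] (K →L[ℂ] K)} {V : H →L[ℂ] K}

theorem norm_matOp_eq (hτ : IsDilation τ V) {n : ℕ} (a : Matrix (Fin n) (Fin n) F) :
    ‖matOp (a.map τ)‖ = ‖subMatOp F a‖ := by
  have compressed_eq (x : F) : ContinuousLinearMap.adjoint V ∘L τ x ∘L V = x := by
    ext ξ
    refine ext_inner_left ℂ fun η => ?_
    rw [ContinuousLinearMap.comp_apply, ContinuousLinearMap.adjoint_inner_right]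
    exact hτ.inner_apply x η ξ
  refine le_antisymm (hτ.norm_matOp_le n a) ?_
  have h := norm_matOp_comp_le (a.map τ)
    ((LinearIsometryEquiv.norm_map ContinuousLinearMap.adjoint V).trans_le hτ.norm_le_one)
    hτ.norm_le_one
  rw [Matrix.map_map] at h
  simpa only [subMatOp, Function.comp_def, compressed_eq] using h

theorem norm_map (hτ : IsDilation τ V) (x : F) : ‖τ x‖ = ‖x‖ :=
  calc ‖τ x‖ = ‖matOp (Matrix.of fun _ _ : Fin 1 => τ x)‖ := (norm_matOp_of_const _).symm
    _ = ‖matOp (Matrix.of fun _ _ : Fin 1 => (x : H →L[ℂ] H))‖ :=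
      hτ.norm_matOp_eq (Matrix.of fun _ _ => x)
    _ = ‖x‖ := norm_matOp_of_const _

theorem injective (hτ : IsDilation τ V) : Function.Injective τ :=
  (AddMonoidHomClass.isometry_of_norm τ hτ.norm_map).injective

end IsDilation

/-- The compression of an operator on `K` to the subspace `L`. -/
def compressTo (L : Submodule ℂ K) [L.HasOrthogonalProjection] :
    (K →L[ℂ] K) →ₗ[ℂ] (L →L[ℂ] L) where
  toFun T := L.orthogonalProjectionOnto ∘L T ∘L L.subtypeL
  map_add' S T := by ext; simp
  map_smul' c T := by ext; simp

section CompressTo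

variable {L : Submodule ℂ K} [L.HasOrthogonalProjection]

theorem inner_compressTo_apply (T : K →L[ℂ] K) (l k : L) :
    ⟪l, compressTo L T k⟫_ℂ = ⟪(l : K), T k⟫_ℂ :=
  Submodule.inner_orthogonalProjectionOnto_eq_of_mem_left _ _

theorem compressTo_one : compressTo L (1 : K →L[ℂ] K) = 1 := by
  ext k
  simp [compressTo]

theorem compressTo_mul_of_mapsTo (S : K →L[ℂ] K) {T : K →L[ℂ] K} (hT : ∀ k ∈ L, T k ∈ L) :
    compressTo L (S * T) = compressTo L S * compressTo L T := by
  ext k : 1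
  have coe_eq : (compressTo L T k : K) = T k :=
    Submodule.starProjection_eq_self_iff.2 (hT k k.2)
  refine ext_inner_left ℂ fun l => ?_
  simp only [inner_compressTo_apply, mul_apply_eq_comp, coe_eq]

theorem compressTo_mul_of_adjoint_mapsTo [CompleteSpace K] {S : K →L[ℂ] K} (T : K →L[ℂ] K)
    (hS : ∀ l ∈ L, ContinuousLinearMap.adjoint S l ∈ L) :
    compressTo L (S * T) = compressTo L S * compressTo L T := by
  ext k : 1
  refine ext_inner_left ℂ fun l => ?_
  let S'l : L := ⟨ContinuousLinearMap.adjoint S l, hS l l.2⟩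
  simp only [inner_compressTo_apply, mul_apply_eq_comp]
  calc ⟪(l : K), S (T k)⟫_ℂ = ⟪(S'l : K), T k⟫_ℂ :=
        (ContinuousLinearMap.adjoint_inner_left S (T k) l).symm
    _ = ⟪(S'l : K), compressTo L T k⟫_ℂ := (inner_compressTo_apply T S'l k).symm
    _ = ⟪(l : K), S (compressTo L T k)⟫_ℂ := ContinuousLinearMap.adjoint_inner_left S _ l

end CompressTo

/-- The closed span of the vectors `f x (V ξ)`. -/
def orbitSpan {X : Type*} (f : X → K →L[ℂ] K) (V : H →L[ℂ] K) : Submodule ℂ K :=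
  (Submodule.span ℂ (Set.range fun p : X × H => f p.1 (V p.2))).topologicalClosure

section OrbitSpan

variable {X : Type*} {f : X → K →L[ℂ] K} {V : H →L[ℂ] K}

instance [CompleteSpace K] : CompleteSpace (orbitSpan f V) :=
  Submodule.topologicalClosure.completeSpace _

theorem apply_mem_orbitSpan (x : X) (ξ : H) : f x (V ξ) ∈ orbitSpan f V :=
  Submodule.le_topologicalClosure _ (Submodule.subset_span ⟨(x, ξ), rfl⟩)

theorem eq_zero_of_mem_orbitSpan {k : K} (hk : k ∈ orbitSpan f V)
    (h : ∀ x ξ, ⟪f x (V ξ), k⟫_ℂ = 0) : k = 0 := by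
  have span_le : Submodule.span ℂ (Set.range fun p : X × H => f p.1 (V p.2)) ≤ (ℂ ∙ k)ᗮ :=
    Submodule.span_le.2 <| Set.range_subset_iff.2 fun p =>
      Submodule.mem_orthogonal_singleton_iff_inner_left.2 (h p.1 p.2)
  have self_orthogonal : k ∈ (ℂ ∙ k)ᗮ :=
    Submodule.topologicalClosure_minimal _ span_le (Submodule.isClosed_orthogonal _) hk
  exact inner_self_eq_zero.1 (Submodule.mem_orthogonal_singleton_iff_inner_left.1 self_orthogonal)

theorem mapsTo_orbitSpan {T : K →L[ℂ] K} (hT : ∀ x, ∃ y, T * f x = f y) :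
    ∀ k ∈ orbitSpan f V, T k ∈ orbitSpan f V := by
  refine Submodule.topologicalClosure_mem_invtSubmodule (f := T) ?_
  refine Submodule.span_le.2 <| Set.range_subset_iff.2 fun p => ?_
  obtain ⟨y, hy⟩ := hT p.1
  exact Submodule.subset_span ⟨(y, p.2), congrArg (· (V p.2)) hy.symm⟩

end OrbitSpan

namespace IsMulDilation

variable [CompleteSpace K] {F : Submodule ℂ (H →L[ℂ] H)} {m : F → F → F} {u : F}
  {τ : F →ₗ[ℂ] (K →L[ℂ] K)} {V : H →L[ℂ] K}

theorem compress (hτ : IsMulDilation m u τ V) {L : Submodule ℂ K} [CompleteSpace L]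
    (hV : ∀ ξ, V ξ ∈ L) (hmul : ∀ x y, compressTo L (τ x * τ y) =
      compressTo L (τ x) * compressTo L (τ y)) :
    IsMulDilation m u (compressTo L ∘ₗ τ) (V.codRestrict L hV) where
  norm_matOp_le n a := (norm_matOp_comp_le (a.map τ) L.orthogonalProjectionOnto_norm_le
    L.norm_subtypeL_le).trans (hτ.norm_matOp_le n a)
  norm_le_one :=
    ContinuousLinearMap.opNorm_le_bound _ zero_le_one (V.le_of_opNorm_le hτ.norm_le_one)
  inner_apply x η ξ := (inner_compressTo_apply _ _ _).trans (hτ.inner_apply x η ξ)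
  map_mul x y := by simp only [LinearMap.comp_apply, hτ.map_mul, hmul]
  map_unit := by rw [LinearMap.comp_apply, hτ.map_unit, compressTo_one]

theorem exists_coseparating (hτ : IsMulDilation m u τ V) :
    ∃ (L : Submodule ℂ K) (_ : CompleteSpace L) (π : F →ₗ[ℂ] (L →L[ℂ] L)) (W : H →L[ℂ] L),
      IsMulDilation m u π W ∧ ∀ k, (∀ b η, ⟪W η, π b k⟫_ℂ = 0) → k = 0 := by
  let adj (x : F) := ContinuousLinearMap.adjoint (τ x)
  have adj_mul (x y) : adj x * adj y = adj (m y x) := by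
    simp only [adj, hτ.map_mul, ← ContinuousLinearMap.star_eq_adjoint, star_mul]
  have V_mem (ξ) : V ξ ∈ orbitSpan adj V := by
    simpa [adj, hτ.map_unit, ← ContinuousLinearMap.star_eq_adjoint] using
      apply_mem_orbitSpan (f := adj) u ξ
  refine ⟨orbitSpan adj V, inferInstance, _, _, hτ.compress V_mem fun x y =>
    compressTo_mul_of_adjoint_mapsTo _ (mapsTo_orbitSpan fun b => ⟨_, adj_mul x b⟩), fun k hk => ?_⟩
  refine Subtype.ext (eq_zero_of_mem_orbitSpan k.2 fun b η => ?_)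
  exact ((ContinuousLinearMap.adjoint_inner_left _ _ _).trans
    (inner_compressTo_apply (τ b) _ k).symm).trans (hk b η)

theorem exists_separating (hτ : IsMulDilation m u τ V)
    (coseparating : ∀ k, (∀ b η, ⟪V η, τ b k⟫_ℂ = 0) → k = 0) :
    ∃ (L : Submodule ℂ K) (_ : CompleteSpace L) (π : F →ₗ[ℂ] (L →L[ℂ] L)) (W : H →L[ℂ] L),
      IsMulDilation m u π W ∧ (∀ k, (∀ b η, ⟪W η, π b k⟫_ℂ = 0) → k = 0) ∧
      ∀ k, (∀ a ξ, ⟪k, π a (W ξ)⟫_ℂ = 0) → k = 0 := by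
  have V_mem (ξ) : V ξ ∈ orbitSpan τ V := by
    simpa [hτ.map_unit] using apply_mem_orbitSpan (f := τ) u ξ
  refine ⟨orbitSpan τ V, inferInstance, _, _, hτ.compress V_mem fun x y =>
    compressTo_mul_of_mapsTo _ (mapsTo_orbitSpan fun a => ⟨_, (hτ.map_mul y a).symm⟩),
    fun k hk => Subtype.ext (coseparating k fun b η => ?_),
    fun k hk => Subtype.ext (eq_zero_of_mem_orbitSpan k.2 fun a ξ => ?_)⟩
  · exact (inner_compressTo_apply (τ b) _ k).symm.trans (hk b η)
  · exact inner_eq_zero_symm.1 ((inner_compressTo_apply (τ a) k _).symm.trans (hk a ξ))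

variable [CompleteSpace H]

theorem norm_mul_le (hτ : IsMulDilation m u τ V) (x y : F) : ‖m x y‖ ≤ ‖x‖ * ‖y‖ := by
  rw [← hτ.norm_map, hτ.map_mul, ← hτ.norm_map x, ← hτ.norm_map y]
  exact _root_.norm_mul_le _ _

/-- A bounded weak limit point of `τ x` is determined by its compressions
`V* τ(b) · τ(a) V`, and these are computed by the product `m`. -/
theorem bddWContinuous_of_separating (hτ : IsMulDilation m u τ V)
    (coseparating : ∀ k, (∀ b η, ⟪V η, τ b k⟫_ℂ = 0) → k = 0)
    (separating : ∀ k, (∀ a ξ, ⟪k, τ a (V ξ)⟫_ℂ = 0) → k = 0)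
    (hl : ∀ b, BddWContinuous fun x => (m b x : H →L[ℂ] H))
    (hr : ∀ a, BddWContinuous fun x => (m x a : H →L[ℂ] H)) : BddWContinuous τ := by
  intro 𝒰 x₀ r bounded tendsto_x₀
  obtain ⟨S, -, tendsto_S⟩ := exists_wTendsto 𝒰 τ
    (bounded.mono fun x hx => (hτ.norm_map x).trans_le hx)
  have inner_mul (b x a η ξ) : ⟪V η, τ b (τ x (τ a (V ξ)))⟫_ℂ =
      ⟪η, (m b (m x a) : H →L[ℂ] H) ξ⟫_ℂ := by
    simp only [← hτ.inner_apply, hτ.map_mul, mul_apply_eq_comp]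
  have bounded_mul (a) : ∀ᶠ x in (𝒰 : Filter F), ‖m x a‖ ≤ r * ‖a‖ := bounded.mono fun x hx =>
    (hτ.norm_mul_le x a).trans (mul_le_mul_of_nonneg_right hx (norm_nonneg a))
  have inner_S (b a η ξ) : ⟪V η, τ b (S (τ a (V ξ)))⟫_ℂ = ⟪V η, τ b (τ x₀ (τ a (V ξ)))⟫_ℂ := by
    have lim_S := tendsto_S (ContinuousLinearMap.adjoint (τ b) (V η)) (τ a (V ξ))
    simp only [ContinuousLinearMap.adjoint_inner_left, inner_mul] at lim_S
    rw [inner_mul]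
    exact tendsto_nhds_unique lim_S
      ((hl b).wTendsto (bounded_mul a) (hr a 𝒰 x₀ r bounded tendsto_x₀) η ξ)
  have S_orbit (a ξ) : S (τ a (V ξ)) = τ x₀ (τ a (V ξ)) :=
    sub_eq_zero.1 <| coseparating _ fun b η => by
      rw [map_sub, inner_sub_right, inner_S, sub_self]
  have S_eq : S = τ x₀ := by
    refine (ContinuousLinearMap.adjoint (𝕜 := ℂ)).injective ?_
    ext k
    refine sub_eq_zero.1 (separating _ fun a ξ => ?_)
    rw [inner_sub_left, ContinuousLinearMap.adjoint_inner_left,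
      ContinuousLinearMap.adjoint_inner_left, S_orbit, sub_self]
  exact S_eq ▸ tendsto_S

theorem exists_bddWContinuous (hτ : IsMulDilation m u τ V)
    (hl : ∀ b, BddWContinuous fun x => (m b x : H →L[ℂ] H))
    (hr : ∀ a, BddWContinuous fun x => (m x a : H →L[ℂ] H)) :
    ∃ (L : Type u) (_ : NormedAddCommGroup L) (_ : InnerProductSpace ℂ L) (_ : CompleteSpace L)
      (π : F →ₗ[ℂ] (L →L[ℂ] L)) (W : H →L[ℂ] L), IsMulDilation m u π W ∧ BddWContinuous π := by
  obtain ⟨K₁, _, τ₁, V₁, hτ₁, coseparating⟩ := hτ.exists_coseparating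
  obtain ⟨K₂, _, τ₂, V₂, hτ₂, coseparating, separating⟩ := hτ₁.exists_separating coseparating
  exact ⟨K₂, inferInstance, inferInstance, inferInstance, τ₂, V₂, hτ₂,
    hτ₂.bddWContinuous_of_separating coseparating separating hl hr⟩

end IsMulDilation

end Compression

/-! ## Ranges of contractive projections -/

section ProjectionRange

variable {H : Type u} [NormedAddCommGroup H] [InnerProductSpace ℂ H]

theorem mul_eq_of_jordanMul_eq {e x : H →L[ℂ] H} (he : jordanMul e e = e)
    (hx : jordanMul e x = x) : e * x = x ∧ x * e = x := by
  have e_mul_e : e * e = e := by simpa [jordanMul, ← two_smul ℂ, smul_smul] using he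
  have sum_eq : e * x + x * e = x + x := by
    rw [← two_smul ℂ x, ← inv_smul_eq_iff₀ two_ne_zero]
    exact hx
  have left_eq : e * x + e * x * e = e * x + e * x := by
    simpa only [mul_add, ← mul_assoc, e_mul_e] using congrArg (e * ·) sum_eq
  have right_eq : e * x * e + x * e = x * e + x * e := by
    simpa only [add_mul, mul_assoc, e_mul_e] using congrArg (· * e) sum_eq
  have comm : e * x = x * e := (add_left_cancel left_eq).symm.trans (add_right_cancel right_eq)
  rw [← comm, ← two_smul ℂ, ← two_smul ℂ] at sum_eq
  have mul_eq : e * x = x := smul_right_injective _ (two_ne_zero (α := ℂ)) sum_eq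
  exact ⟨mul_eq, comm ▸ mul_eq⟩

theorem jordanMul_one (x : H →L[ℂ] H) : jordanMul 1 x = x := by
  simp [jordanMul, ← two_smul ℂ, smul_smul]

theorem IsDilation.comp_inclusion {K : Type u} [NormedAddCommGroup K] [InnerProductSpace ℂ K]
    [CompleteSpace K] {E F : Submodule ℂ (H →L[ℂ] H)} {τ : F →ₗ[ℂ] (K →L[ℂ] K)} {V : H →L[ℂ] K}
    (hτ : IsDilation τ V) (hEF : E ≤ F) : IsDilation (τ ∘ₗ Submodule.inclusion hEF) V where
  norm_matOp_le n a := hτ.norm_matOp_le n (a.map (Submodule.inclusion hEF))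
  norm_le_one := hτ.norm_le_one
  inner_apply x := hτ.inner_apply (Submodule.inclusion hEF x)

/-- A contractive idempotent real completely positive map on `B(H)` that extends `P` and maps `1`
into the range of `P`. -/
structure IsProjectionExtension {M : Submodule ℂ (H →L[ℂ] H)} (P : M →ₗ[ℂ] M)
    (Q : (H →L[ℂ] H) →ₗ[ℂ] (H →L[ℂ] H)) : Prop where
  isRCP : IsRCP Q
  norm_map_one_le : ‖Q 1‖ ≤ 1
  map_map : ∀ b, Q (Q b) = Q b
  apply_coe : ∀ x : M, Q x = P x
  map_one_mem : Q 1 ∈ rangeSpace P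

theorem IsProjectionExtension.apply_eq_self {M : Submodule ℂ (H →L[ℂ] H)} {P : M →ₗ[ℂ] M}
    {Q : (H →L[ℂ] H) →ₗ[ℂ] (H →L[ℂ] H)} (hQ : IsProjectionExtension P Q) :
    ∀ x ∈ rangeSpace P, Q x = x := by
  rintro _ ⟨x, rfl⟩
  rw [LinearMap.comp_apply, Submodule.subtype_apply, ← hQ.apply_coe, hQ.map_map]

variable [CompleteSpace H]

theorem IsBddWClosed.bddWContinuous {F : Submodule ℂ (H →L[ℂ] H)} (hF : IsBddWClosed F)
    {f : F → F} {C : ℝ} (hC : 0 ≤ C) (norm_le : ∀ x, ‖f x‖ ≤ C * ‖x‖)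
    (limit_eq : ∀ (𝒰 : Ultrafilter F) (x₀ z : F) (r : ℝ), (∀ᶠ x in (𝒰 : Filter F), ‖x‖ ≤ r) →
      WTendsto (fun x : F => (x : H →L[ℂ] H)) 𝒰 x₀ →
      WTendsto (fun x => (f x : H →L[ℂ] H)) 𝒰 z → f x₀ = z) :
    BddWContinuous fun x => (f x : H →L[ℂ] H) := by
  intro 𝒰 x₀ r bounded tendsto_x₀
  have bounded_f : ∀ᶠ x in (𝒰 : Filter F), ‖f x‖ ≤ C * r :=
    bounded.mono fun x hx => (norm_le x).trans (mul_le_mul_of_nonneg_left hx hC)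
  obtain ⟨z, -, hz⟩ := exists_wTendsto 𝒰 (fun x => (f x : H →L[ℂ] H)) bounded_f
  have z_mem : z ∈ F := hF.mem_of_wTendsto (fun x => (f x).2) bounded_f hz
  have eq_z : f x₀ = ⟨z, z_mem⟩ := limit_eq 𝒰 x₀ ⟨z, z_mem⟩ r bounded tendsto_x₀ hz
  simpa only [eq_z] using hz

theorem star_eq_self_of_mul_self {e : H →L[ℂ] H} (he : e * e = e) (hn : ‖e‖ ≤ 1) :
    star e = e := by
  have star_mul_self : star e * e = e := by
    ext ξ
    refine eq_of_norm_le_re_inner_eq_norm_sq (𝕜 := ℂ)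
      (by simpa using (star e).le_of_opNorm_le ((norm_star e).trans_le hn) (e ξ)) ?_
    have fixed : e (e ξ) = e ξ := congrArg (· ξ) he
    rw [mul_apply_eq_comp, ContinuousLinearMap.star_eq_adjoint,
      ContinuousLinearMap.adjoint_inner_left, fixed, inner_self_eq_norm_sq]
  rw [← star_mul_self, star_mul, star_star]

section MulContinuity

variable {Q : (H →L[ℂ] H) →ₗ[ℂ] (H →L[ℂ] H)} (hQ : IsRCP Q) (h1 : ‖Q 1‖ ≤ 1)
  (hid : ∀ b, Q (Q b) = Q b) {F : Submodule ℂ (H →L[ℂ] H)} (hF : IsBddWClosed F)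
  (hQF : ∀ x ∈ F, Q x = x) {m : F → F → F} (hm : ∀ x y, (m x y : H →L[ℂ] H) = Q (x * y))

include hQ h1 hid hF hQF hm

theorem IsRCP.bddWContinuous_mul_left (a : F) : BddWContinuous fun x => (m a x : H →L[ℂ] H) := by
  refine hF.bddWContinuous (norm_nonneg a) (fun x => ?_)
    fun 𝒰 x₀ z r bounded tendsto_x₀ tendsto_z => Subtype.ext ?_
  · rw [Submodule.coe_norm, hm]
    exact (hQ.norm_map_le h1 _).trans (norm_mul_le _ _)
  · have h := hQ.map_eq_of_wTendsto h1 hid (hQF a a.2) 𝒰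
      (y := fun x => (x : H →L[ℂ] H)) bounded (y₀ := x₀) (z := z)
      (by simpa only [hQF _ (Subtype.prop _)] using tendsto_x₀) (by simpa only [hm] using tendsto_z)
    rw [hm, ← h, hQF z z.2]

theorem IsRCP.bddWContinuous_mul_right (a : F) :
    BddWContinuous fun x => (m x a : H →L[ℂ] H) := by
  have map_star_eq (x : F) : Q (star (x : H →L[ℂ] H)) = star (x : H →L[ℂ] H) := by
    rw [hQ.map_star, hQF x x.2]
  refine hF.bddWContinuous (norm_nonneg a) (fun x => ?_)
    fun 𝒰 x₀ z r bounded tendsto_x₀ tendsto_z => Subtype.ext ?_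
  · rw [Submodule.coe_norm, hm, mul_comm]
    exact (hQ.norm_map_le h1 _).trans (norm_mul_le _ _)
  · have h := hQ.map_eq_of_wTendsto h1 hid (map_star_eq a) 𝒰 (y := fun x => star (x : H →L[ℂ] H))
      (C := r) (by simp only [norm_star]; exact bounded) (y₀ := star (x₀ : H →L[ℂ] H)) (z := star z)
      (by simpa only [map_star_eq] using tendsto_x₀.star)
      (by simpa only [hm, ← hQ.map_star, star_mul] using tendsto_z.star)
    rw [← star_mul, hQ.map_star, hQ.map_star, star_inj, hQF z z.2] at h
    rw [hm, h]

end MulContinuity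

section Restriction

variable {K : Type u} [NormedAddCommGroup K] [InnerProductSpace ℂ K] [CompleteSpace K]
  {F : Submodule ℂ (H →L[ℂ] H)} {τ : F →ₗ[ℂ] (K →L[ℂ] K)} {V : H →L[ℂ] K}

theorem IsDilation.isCompletelyIsometric (hτ : IsDilation τ V) :
    IsCompletelyIsometric (LinearEquiv.ofInjective τ hτ.injective).toLinearMap :=
  fun _ => hτ.norm_matOp_eq

theorem IsDilation.isClosed_range (hτ : IsDilation τ V) (hF : IsClosed (F : Set (H →L[ℂ] H))) :
    IsClosed (LinearMap.range τ : Set (K →L[ℂ] K)) := by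
  have : CompleteSpace F := hF.completeSpace_coe
  rw [LinearMap.coe_range]
  exact (AddMonoidHomClass.isometry_of_norm τ hτ.norm_map).isClosedEmbedding.isClosed_range

end Restriction

section Projections

variable {M : Submodule ℂ (H →L[ℂ] H)} {P : M →ₗ[ℂ] M}

theorem IsCompletelyContractive.norm_map_le (hP : IsCompletelyContractive P) (x : M) :
    ‖P x‖ ≤ ‖x‖ :=
  calc ‖P x‖ = ‖matOp (Matrix.of fun _ _ : Fin 1 => (P x : H →L[ℂ] H))‖ :=
      (norm_matOp_of_const _).symm
    _ ≤ ‖matOp (Matrix.of fun _ _ : Fin 1 => (x : H →L[ℂ] H))‖ := hP 1 (Matrix.of fun _ _ => x)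
    _ = ‖x‖ := norm_matOp_of_const _

theorem isClosed_rangeSpace (hM : IsClosed (M : Set (H →L[ℂ] H))) (hPP : P ∘ₗ P = P)
    (norm_le : ∀ x, ‖P x‖ ≤ ‖x‖) : IsClosed (rangeSpace P : Set (H →L[ℂ] H)) := by
  have continuous_P : Continuous P :=
    (P.mkContinuous 1 fun x => (norm_le x).trans_eq (one_mul _).symm).continuous
  have range_eq : (rangeSpace P : Set (H →L[ℂ] H)) = Subtype.val '' {x : M | P x = x} := by
    ext T
    constructor
    · rintro ⟨x, rfl⟩
      exact ⟨P x, DFunLike.congr_fun hPP x, rfl⟩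
    · rintro ⟨x, hx, rfl⟩
      exact ⟨x, congrArg Subtype.val hx⟩
  rw [range_eq]
  exact hM.isClosedEmbedding_subtypeVal.isClosedMap _ (isClosed_eq continuous_P continuous_id)

theorem exists_isProjectionExtension (hP : IsRealCompletelyPositive P) (hPP : P ∘ₗ P = P)
    (norm_le : ∀ x, ‖P x‖ ≤ ‖x‖) {e : H →L[ℂ] H} (he : e ∈ M) (hen : ‖e‖ ≤ 1)
    (hunit : ∀ x ∈ M, e * x = x ∧ x * e = x) : ∃ Q, IsProjectionExtension P Q := by
  have norm_map_e_le : ‖P ⟨e, he⟩‖ ≤ 1 := (norm_le _).trans hen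
  obtain ⟨Q, hQ, hid, hQP, hQ1⟩ := exists_idempotent_isRCP_extension hP hPP he
    (star_eq_self_of_mul_self (hunit e he).1 hen) hunit norm_map_e_le
  exact ⟨Q, hQ, hQ1 ▸ norm_map_e_le, hid, hQP, hQ1 ▸ ⟨_, rfl⟩⟩

namespace IsProjectionExtension

variable {Q : (H →L[ℂ] H) →ₗ[ℂ] (H →L[ℂ] H)}

theorem exists_dilation (hQ : IsProjectionExtension P Q) :
    ∃ (K : Type u) (_ : NormedAddCommGroup K) (_ : InnerProductSpace ℂ K) (_ : CompleteSpace K)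
      (τ : rangeSpace P →ₗ[ℂ] (K →L[ℂ] K)) (V : H →L[ℂ] K), IsDilation τ V ∧
        (∀ x y z : rangeSpace P, Q (x * y) = z → τ z = τ x * τ y) ∧
        (∀ x y z : rangeSpace P, Q (jordanMul x y) = z → τ z = jordanMul (τ x) (τ y)) ∧
        τ ⟨Q 1, hQ.map_one_mem⟩ = 1 := by
  obtain ⟨K, _, _, _, σ, V, hσ⟩ :=
    exists_isMulDilation_choiEffrosMul hQ.isRCP hQ.norm_map_one_le hQ.map_map
  have range_le : rangeSpace P ≤ LinearMap.range Q := fun x hx => ⟨x, hQ.apply_eq_self x hx⟩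
  let ι := Submodule.inclusion range_le
  refine ⟨K, inferInstance, inferInstance, inferInstance, σ ∘ₗ ι, V,
    hσ.comp_inclusion range_le, fun x y z hz => ?_, fun x y z hz => ?_, hσ.map_unit⟩
  · have ι_eq : ι z = choiEffrosMul Q (ι x) (ι y) := Subtype.ext hz.symm
    simp only [LinearMap.comp_apply, ι_eq, hσ.map_mul]
  · have ι_eq : ι z = (2⁻¹ : ℂ) • (choiEffrosMul Q (ι x) (ι y) + choiEffrosMul Q (ι y) (ι x)) :=
      Subtype.ext (hz.symm.trans (by rw [jordanMul, map_smul, map_add]; rfl))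
    simp only [LinearMap.comp_apply, ι_eq, map_smul, map_add, hσ.map_mul, jordanMul]

end IsProjectionExtension

theorem isUnitalDualOperatorAlgebraWith_newMul (hM : IsUnitalOperatorAlgebra M)
    (hP : IsRealCompletelyPositive P) (hPP : P ∘ₗ P = P) (hPc : IsCompletelyContractive P)
    (hF : IsWeakStarClosed (rangeSpace P)) :
    IsUnitalDualOperatorAlgebraWith (rangeSpace P) (newMul hM P) := by
  obtain ⟨e, he, hen, hunit⟩ := hM.exists_unit
  obtain ⟨Q, hQ⟩ := exists_isProjectionExtension hP hPP hPc.norm_map_le he hen hunit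
  obtain ⟨K, _, _, _, τ, V, hτ, hτ_mul, -, hτ_unit⟩ := hQ.exists_dilation
  have coe_newMul (x y : rangeSpace P) : (newMul hM P x y : H →L[ℂ] H) = Q (x * y) :=
    (hQ.apply_coe _).symm
  have isMulDilation : IsMulDilation (newMul hM P) ⟨Q 1, hQ.map_one_mem⟩ τ V :=
    ⟨hτ, fun x y => hτ_mul x y _ (coe_newMul x y).symm, hτ_unit⟩
  obtain ⟨L, _, _, _, π, W, hπ, bddWContinuous_π⟩ := isMulDilation.exists_bddWContinuous
    (hQ.isRCP.bddWContinuous_mul_left hQ.norm_map_one_le hQ.map_map hF.isBddWClosed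
      hQ.apply_eq_self coe_newMul)
    (hQ.isRCP.bddWContinuous_mul_right hQ.norm_map_one_le hQ.map_map hF.isBddWClosed
      hQ.apply_eq_self coe_newMul)
  have isUnitalOperatorAlgebra_range : IsUnitalOperatorAlgebra (LinearMap.range π) := by
    refine ⟨hπ.isClosed_range hF.isBddWClosed.isClosed, ?_, 1, ⟨_, hπ.map_unit⟩,
      ContinuousLinearMap.norm_id_le, fun x _ => ⟨one_mul x, mul_one x⟩⟩
    rintro _ ⟨x, rfl⟩ _ ⟨y, rfl⟩
    exact ⟨_, hπ.map_mul x y⟩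
  let π' : rangeSpace P ≃ₗ[ℂ] LinearMap.range π := LinearEquiv.ofInjective π hπ.injective
  have norm_π' (x : rangeSpace P) : ‖π' x‖ = ‖x‖ := hπ.norm_map x
  exact ⟨hF, L, inferInstance, inferInstance, inferInstance, LinearMap.range π, π',
    isUnitalOperatorAlgebra_range, hF.of_linearEquiv norm_π' bddWContinuous_π,
    hπ.isCompletelyIsometric,
    hF.isWeakStarContinuous π'.toLinearMap (fun x => (norm_π' x).le) bddWContinuous_π,
    hF.isWeakStarContinuous_symm norm_π' bddWContinuous_π, hπ.map_mul⟩

theorem isUnitalJordanOperatorAlgebraWith_newJordanMul (hM : IsUnitalJordanOperatorAlgebra M)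
    (hP : IsRealCompletelyPositive P) (hPP : P ∘ₗ P = P) (hPc : IsCompletelyContractive P) :
    IsUnitalJordanOperatorAlgebraWith (rangeSpace P) (newJordanMul hM P) := by
  obtain ⟨e, he, hen, hunit⟩ := hM.exists_unit
  obtain ⟨Q, hQ⟩ := exists_isProjectionExtension hP hPP hPc.norm_map_le he hen fun x hx =>
    mul_eq_of_jordanMul_eq (hunit e he) (hunit x hx)
  obtain ⟨K, _, _, _, τ, V, hτ, -, hτ_jordanMul, hτ_unit⟩ := hQ.exists_dilation
  have map_newJordanMul (x y : rangeSpace P) :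
      τ (newJordanMul hM P x y) = jordanMul (τ x) (τ y) :=
    hτ_jordanMul x y (newJordanMul hM P x y) <| hQ.apply_coe
      ⟨jordanMul x y, hM.jordanMul_mem _ (rangeSpace_le P x.2) _ (rangeSpace_le P y.2)⟩
  refine ⟨K, inferInstance, inferInstance, inferInstance, LinearMap.range τ,
    LinearEquiv.ofInjective τ hτ.injective,
    ⟨hτ.isClosed_range (isClosed_rangeSpace hM.isClosed hPP hPc.norm_map_le), ?_, 1,
      ⟨_, hτ_unit⟩, ContinuousLinearMap.norm_id_le, fun x _ => jordanMul_one x⟩,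
    hτ.isCompletelyIsometric, map_newJordanMul⟩
  rintro _ ⟨x, rfl⟩ _ ⟨y, rfl⟩
  exact ⟨_, map_newJordanMul x y⟩

end Projections

end ProjectionRange

/-! ## The mean ergodic projection -/

section MeanErgodic

theorem norm_inv_smul_sum_range_le {E : Type*} [SeminormedAddCommGroup E] [NormedSpace ℂ E]
    {x : ℕ → E} {C : ℝ} (hC : 0 ≤ C) (hx : ∀ k, ‖x k‖ ≤ C) (n : ℕ) :
    ‖(n : ℂ)⁻¹ • ∑ k ∈ Finset.range n, x k‖ ≤ C := by
  calc ‖(n : ℂ)⁻¹ • ∑ k ∈ Finset.range n, x k‖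
      = (n : ℝ)⁻¹ * ‖∑ k ∈ Finset.range n, x k‖ := by
        rw [norm_smul, norm_inv, Complex.norm_natCast]
    _ ≤ (n : ℝ)⁻¹ * (n * C) := by
        gcongr
        simpa using norm_sum_le_of_le (Finset.range n) fun k _ => hx k
    _ = ((n : ℝ)⁻¹ * n) * C := (mul_assoc _ _ _).symm
    _ ≤ C := mul_le_of_le_one_left hC inv_mul_le_one

variable {H : Type u} [NormedAddCommGroup H] [InnerProductSpace ℂ H]

variable {M : Submodule ℂ (H →L[ℂ] H)} {Φ : M →ₗ[ℂ] M}

theorem mem_fixedSpace_iff {T : H →L[ℂ] H} :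
    T ∈ fixedSpace Φ ↔ ∃ hT : T ∈ M, Φ ⟨T, hT⟩ = ⟨T, hT⟩ := by
  simp [fixedSpace, LinearMap.mem_eqLocus]

/-- The Cesàro mean of the first `n` iterates of `Φ`, which is `0` for `n = 0`. -/
def cesaro (Φ : M →ₗ[ℂ] M) (n : ℕ) : M →ₗ[ℂ] M :=
  (n : ℂ)⁻¹ • ∑ k ∈ Finset.range n, Φ ^ k

theorem cesaro_apply (n : ℕ) (x : M) : cesaro Φ n x = birkhoffAverage ℂ Φ id n x := by
  simp [cesaro, birkhoffAverage, birkhoffSum, Module.End.pow_apply]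

theorem cesaro_map (n : ℕ) (x : M) : cesaro Φ n (Φ x) = Φ (cesaro Φ n x) := by
  simp only [cesaro, LinearMap.smul_apply, LinearMap.sum_apply, map_smul, map_sum,
    ← Module.End.mul_apply, ← pow_succ, ← pow_succ']

/-- `P` is a point-weak limit of the Cesàro means of `Φ` along a nonprincipal ultrafilter. -/
def IsErgodicLimit (Φ P : M →ₗ[ℂ] M) : Prop :=
  ∀ x, WTendsto (fun n => (cesaro Φ n x : H →L[ℂ] H)) (hyperfilter ℕ) (P x)

theorem IsErgodicLimit.apply_eq_self {P : M →ₗ[ℂ] M} (hP : IsErgodicLimit Φ P) {x : M}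
    (hx : Φ x = x) : P x = x := by
  have eventually_eq : ∀ᶠ n in (hyperfilter ℕ : Filter ℕ),
      (x : H →L[ℂ] H) = cesaro Φ n x := by
    filter_upwards [Nat.hyperfilter_le_atTop (eventually_ne_atTop 0)] with n hn
    rw [cesaro_apply, Function.IsFixedPt.birkhoffAverage_eq ℂ hx id (Nat.cast_ne_zero.2 hn), id]
  exact Subtype.ext (((hP x).congr' eventually_eq).unique (wTendsto_const _ _))

theorem IsCompletelyContractive.pow (hΦ : IsCompletelyContractive Φ) (k : ℕ) :
    IsCompletelyContractive (Φ ^ k) := by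
  induction k with
  | zero => exact fun n a => le_rfl
  | succ k ih => exact fun n a => (ih n _).trans (hΦ n a)

variable [CompleteSpace H]

theorem IsWeakStarContinuous.wTendsto (hΦ : IsWeakStarContinuous Φ) {α : Type*} {l : Filter α}
    {x : α → M} {x₀ : M} (h : WTendsto (fun a => (x a : H →L[ℂ] H)) l x₀) {C : ℝ}
    (hC : ∀ᶠ a in l, ‖x a‖ ≤ C) : WTendsto (fun a => (Φ (x a) : H →L[ℂ] H)) l (Φ x₀) := by
  let _ := weakStar H
  let _ := relWeakStar M
  have continuous_Φ : Continuous Φ := hΦ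
  have tendsto_x : Tendsto x l (𝓝 x₀) := tendsto_subtype_rng.2 (h.tendsto_weakStar hC)
  exact wTendsto_of_tendsto_weakStar
    (tendsto_subtype_rng.1 ((continuous_Φ.tendsto x₀).comp tendsto_x))

theorem isWeakStarClosed_fixedSpace (hM : IsWeakStarClosed M) (hΦ : IsWeakStarContinuous Φ) :
    IsWeakStarClosed (fixedSpace Φ) := by
  refine IsBddWClosed.isWeakStarClosed fun 𝒰 T₀ r bounded hT₀ => ?_
  choose mem_M map_eq using fun x : fixedSpace Φ => mem_fixedSpace_iff.1 x.2
  have T₀_mem : T₀ ∈ M := hM.isBddWClosed.mem_of_wTendsto mem_M bounded hT₀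
  have tendsto_map := hΦ.wTendsto (x := fun x : fixedSpace Φ => ⟨x, mem_M x⟩)
    (x₀ := ⟨T₀, T₀_mem⟩) hT₀ bounded
  simp only [map_eq] at tendsto_map
  exact mem_fixedSpace_iff.2 ⟨T₀_mem, Subtype.ext (tendsto_map.unique hT₀)⟩

theorem IsRealCompletelyPositive.pow (hΦ : IsRealCompletelyPositive Φ) (k : ℕ) :
    IsRealCompletelyPositive (Φ ^ k) := by
  induction k with
  | zero => exact fun _ _ h => h
  | succ _ ih => exact fun n a h => ih n _ (hΦ n a h)

theorem subMatOp_map_cesaro (n : ℕ) {m : ℕ} (a : Matrix (Fin m) (Fin m) M) :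
    subMatOp M (a.map (cesaro Φ n)) =
      (n : ℂ)⁻¹ • ∑ k ∈ Finset.range n, subMatOp M (a.map ⇑(Φ ^ k)) := by
  have cesaro_eq (x : M) : (cesaro Φ n x : H →L[ℂ] H) =
      (n : ℂ)⁻¹ • ∑ k ∈ Finset.range n, ((Φ ^ k) x : H →L[ℂ] H) := by
    simp [cesaro]
  ext v i
  rw [subMatOp, matOp_apply]
  simp only [Matrix.map_apply, cesaro_eq, smul_apply, sum_apply, PiLp.smul_apply, WithLp.ofLp_sum,
    Finset.sum_apply, subMatOp, matOp_apply, ← Finset.smul_sum]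
  rw [Finset.sum_comm]

theorem IsCompletelyContractive.cesaro (hΦ : IsCompletelyContractive Φ) (n : ℕ) :
    IsCompletelyContractive (cesaro Φ n) := by
  intro m a
  rw [subMatOp_map_cesaro]
  exact norm_inv_smul_sum_range_le (x := fun k => subMatOp M (a.map ⇑(Φ ^ k))) (norm_nonneg _)
    (fun k => hΦ.pow k m a) n

theorem IsRealCompletelyPositive.cesaro (hΦ : IsRealCompletelyPositive Φ) (n : ℕ) :
    IsRealCompletelyPositive (cesaro Φ n) := by
  intro m a ha
  rw [subMatOp_map_cesaro, isRealPositive_iff]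
  intro v
  have term_nonneg (k : ℕ) := (isRealPositive_iff _).1 (hΦ.pow k m a ha) v
  rw [smul_apply, sum_apply, inner_smul_right, inner_sum, ← Complex.ofReal_natCast,
    ← Complex.ofReal_inv, Complex.re_ofReal_mul, Complex.re_sum]
  exact mul_nonneg (by positivity) (Finset.sum_nonneg fun k _ => term_nonneg k)

section Limit

variable {α : Type*} {l : Filter α} {T : α → M →ₗ[ℂ] M} {P : M →ₗ[ℂ] M}

theorem wTendsto_subMatOp_map (hP : ∀ x, WTendsto (fun a => (T a x : H →L[ℂ] H)) l (P x)) {n : ℕ}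
    (a : Matrix (Fin n) (Fin n) M) :
    WTendsto (fun t => subMatOp M (a.map (T t))) l (subMatOp M (a.map P)) := by
  intro η ξ
  simp only [PiLp.inner_apply, subMatOp, matOp_apply, inner_sum, Matrix.map_apply]
  exact tendsto_finsetSum _ fun i _ => tendsto_finsetSum _ fun j _ => hP _ _ _

variable [l.NeBot]

theorem isRealCompletelyPositive_of_wTendsto (hT : ∀ a, IsRealCompletelyPositive (T a))
    (hP : ∀ x, WTendsto (fun a => (T a x : H →L[ℂ] H)) l (P x)) : IsRealCompletelyPositive P := by
  intro n a ha
  rw [isRealPositive_iff]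
  intro v
  exact ge_of_tendsto ((Complex.continuous_re.tendsto _).comp (wTendsto_subMatOp_map hP a v v))
    (Eventually.of_forall fun t => (isRealPositive_iff _).1 (hT t n a ha) v)

theorem isCompletelyContractive_of_wTendsto (hT : ∀ a, IsCompletelyContractive (T a))
    (hP : ∀ x, WTendsto (fun a => (T a x : H →L[ℂ] H)) l (P x)) : IsCompletelyContractive P :=
  fun n a => (wTendsto_subMatOp_map hP a).norm_le (Eventually.of_forall fun t => hT t n a)

end Limit

theorem exists_isErgodicLimit (hM : IsBddWClosed M) (hΦ : IsCompletelyContractive Φ) :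
    ∃ P, IsErgodicLimit Φ P := by
  have bounded (x : M) : ∀ᶠ n in (hyperfilter ℕ : Filter ℕ),
      ‖(M.subtype ∘ₗ cesaro Φ n) x‖ ≤ ‖x‖ :=
    Eventually.of_forall fun n => (hΦ.cesaro n).norm_map_le x
  obtain ⟨P, hP⟩ := exists_linearMap_wTendsto _ _ bounded
  have P_mem (x : M) : P x ∈ M := hM.mem_of_wTendsto (fun n => (cesaro Φ n x).2) (bounded x) (hP x)
  exact ⟨P.codRestrict M P_mem, hP⟩

namespace IsErgodicLimit

variable {P : M →ₗ[ℂ] M}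

theorem apply_map (hP : IsErgodicLimit Φ P) (hΦ : IsCompletelyContractive Φ) (x : M) :
    P (Φ x) = P x := by
  have bounded : Bornology.IsBounded (Set.range fun n => id (Φ^[n] x)) := by
    refine isBounded_iff_forall_norm_le.2 ⟨‖x‖, ?_⟩
    rintro _ ⟨n, rfl⟩
    simpa only [id, Module.End.pow_apply] using (hΦ.pow n).norm_map_le x
  have tendsto_zero : Tendsto (fun n => (cesaro Φ n (Φ x) : H →L[ℂ] H) - cesaro Φ n x)
      (hyperfilter ℕ) (𝓝 0) := by
    have h := tendsto_birkhoffAverage_apply_sub_birkhoffAverage ℂ bounded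
    simp only [← cesaro_apply] at h
    exact ((continuous_subtype_val.tendsto _).comp h).mono_left Nat.hyperfilter_le_atTop
  exact Subtype.ext (sub_eq_zero.1
    (((hP (Φ x)).sub (hP x)).unique (wTendsto_of_tendsto tendsto_zero)))

theorem map_apply (hP : IsErgodicLimit Φ P) (hΦw : IsWeakStarContinuous Φ)
    (hΦ : IsCompletelyContractive Φ) (x : M) : Φ (P x) = P x := by
  have tendsto_map := hΦw.wTendsto (hP x)
    (Eventually.of_forall fun n => (hΦ.cesaro n).norm_map_le x)
  simp only [← cesaro_map] at tendsto_map
  exact (Subtype.ext (tendsto_map.unique (hP (Φ x)))).trans (hP.apply_map hΦ x)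

end IsErgodicLimit

theorem exists_fixedSpace_projection (hM : IsWeakStarClosed M) (hΦw : IsWeakStarContinuous Φ)
    (hΦp : IsRealCompletelyPositive Φ) (hΦc : IsCompletelyContractive Φ) :
    ∃ P : M →ₗ[ℂ] M, P ∘ₗ P = P ∧ rangeSpace P = fixedSpace Φ ∧
      IsRealCompletelyPositive P ∧ IsCompletelyContractive P := by
  obtain ⟨P, hP⟩ := exists_isErgodicLimit hM.isBddWClosed hΦc
  have map_apply (x : M) : Φ (P x) = P x := hP.map_apply hΦw hΦc x
  refine ⟨P, LinearMap.ext fun x => hP.apply_eq_self (map_apply x), le_antisymm ?_ ?_,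
    isRealCompletelyPositive_of_wTendsto hΦp.cesaro hP,
    isCompletelyContractive_of_wTendsto hΦc.cesaro hP⟩
  · rintro _ ⟨x, rfl⟩
    exact ⟨P x, map_apply x, rfl⟩
  · rintro _ ⟨x, hx, rfl⟩
    exact ⟨x, congrArg Subtype.val (hP.apply_eq_self hx)⟩

end MeanErgodic

end

end OperatorAlg

theorem corollary3p6 {H : Type*} [NormedAddCommGroup H] [InnerProductSpace ℂ H]
    [CompleteSpace H] (M : Submodule ℂ (H →L[ℂ] H)) (hMw : OperatorAlg.IsWeakStarClosed M)
    (Φ : M →ₗ[ℂ] M) (hΦw : OperatorAlg.IsWeakStarContinuous Φ)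
    (hΦp : OperatorAlg.IsRealCompletelyPositive Φ)
    (hΦc : OperatorAlg.IsCompletelyContractive Φ) :
    (∀ hM : OperatorAlg.IsUnitalOperatorAlgebra M,
      ∃ P : M →ₗ[ℂ] M, P ∘ₗ P = P ∧
        OperatorAlg.rangeSpace P = OperatorAlg.fixedSpace Φ ∧
        OperatorAlg.IsRealCompletelyPositive P ∧
        OperatorAlg.IsCompletelyContractive P ∧
        OperatorAlg.IsUnitalDualOperatorAlgebraWith (OperatorAlg.rangeSpace P)
          (OperatorAlg.newMul hM P)) ∧
    (∀ hM : OperatorAlg.IsUnitalJordanOperatorAlgebra M,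
      ∃ P : M →ₗ[ℂ] M, P ∘ₗ P = P ∧
        OperatorAlg.rangeSpace P = OperatorAlg.fixedSpace Φ ∧
        OperatorAlg.IsRealCompletelyPositive P ∧
        OperatorAlg.IsCompletelyContractive P ∧
        OperatorAlg.IsUnitalJordanOperatorAlgebraWith (OperatorAlg.rangeSpace P)
          (OperatorAlg.newJordanMul hM P)) := by
  obtain ⟨P, hPP, hPF, hPp, hPc⟩ := OperatorAlg.exists_fixedSpace_projection hMw hΦw hΦp hΦc
  have range_closed : OperatorAlg.IsWeakStarClosed (OperatorAlg.rangeSpace P) :=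
    hPF ▸ OperatorAlg.isWeakStarClosed_fixedSpace hMw hΦw
  exact ⟨fun hM => ⟨P, hPP, hPF, hPp, hPc,
      OperatorAlg.isUnitalDualOperatorAlgebraWith_newMul hM hPp hPP hPc range_closed⟩,
    fun hM => ⟨P, hPP, hPF, hPp, hPc,
      OperatorAlg.isUnitalJordanOperatorAlgebraWith_newJordanMul hM hPp hPP hPc⟩⟩
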